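/- Let $\Omega=(-1,1)^2\subset\mathbb R^2$ and $u=(-1,0)\,\chi_{\{x_1>0\}}$, and for $\varepsilon>0$ let $$u_\varepsilon=(-1,0)\,\chi_{\{x_1>0\}}+\Big(\frac{2}{\varepsilon},0\Big)\chi_{\{-2\varepsilon<x_1<0\}},\qquad y_\varepsilon=\mathbf{id}+\varepsilon u_\varepsilon\quad\text{on }\Omega .$$ Notation. For a measurable $f:\Omega\to\mathbb R^2$, $J_f$ is the set of approximate jump points of $f$, i.e. of those $x\in\Omega$ for which there are a unit vector $\nu_f$ and $f^+\neq f^-$ in $\mathbb R^2$ that are the approximate limits of $f(z)$ as $z\to x$ with $(z-x)\cdot\nu_f>0$ and with $(z-x)\cdot\nu_f<0$, respectively; $[f]=f^+-f^-$. $\nabla f$ and $e(f)$ are the approximate gradient and the approximate symmetric gradient. $GSBV^2(\Omega;\mathbb R^2)$ (resp. $GSBD^2(\Omega)$) is the set of $f\in GSBV(\Omega;\mathbb R^2)$ with $\nabla f\in L^2$ (resp. of $f\in GSBD(\Omega)$ with $e(f)\in L^2$) and $\mathcal H^1(J_f)<\infty$. The linearized energy is $\mathcal F(f)=\|e(f)\|_{L^2(\Omega)}^2+\mathcal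 H^1(J_f)$. A map $y\in GSBV(\Omega;\mathbb R^2)$ satisfies the Ciarlet–Nečas condition (CN) if $\det\nabla y>0$ a.e. in $\Omega$ and $\int_\Omega\det\nabla y\,dx\le\mathcal L^2([y(\Omega)])$, where the measure theoretic image $[y(\Omega)]$ is the image of $\Omega$ under the map equal to the approximate limit of $y$ at the points of approximate differentiability of $y$ and to $0$ elsewhere. A map $f\in GSBD^2(\Omega)$ satisfies the contact condition (CC) if $\nu_f\cdot[f]\ge0$ $\mathcal H^1$-a.e. on $J_f$. Then: 1. $u\in GSBD^2(\Omega)$, $J_u=\{0\}\times(-1,1)$, and on $J_u$ one has $\nu_u=e_1$, $[u]=-e_1$ (up to the simultaneous change of sign of $\nu_u$ and $[u]$), so that $\nu_u\cdot[u]=-1$ on $J_u$; in particular $u$ violates (CC). 2. For every $\varepsilon>0$: $y_\varepsilon,u_\varepsilon\in GSBV^2(\Omega;\mathbb R^2)$, $u_\varepsilon=\frac1\varepsilon(y_\varepsilon-\mathbf{id})$, $\nabla y_\varepsilon=\mathbf{Id}$ and $\nabla u_\varepsilon=0$ a.e. in $\Omega$, $y_\varepsilon$ satisfies (CN), $\mathcal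 F(u_\varepsilon)=\mathcal H^1(J_{y_\varepsilon})\le4$, and $\mathcal H^1(J_{y_\varepsilon})=4$ if $\varepsilon<\frac12$. In particular $\sup_{\varepsilon>0}\mathcal F(u_\varepsilon)<\infty$. 3. $u_\varepsilon\to u$ in measure on $\Omega$ as $\varepsilon\to0^+$. Consequently (CN) and energy bounds alone do not give (CC) in the limit: it is not true that, for every family $(y_\varepsilon)_{\varepsilon>0}\subset GSBV^2(\Omega;\mathbb R^2)$ satisfying (CN) and every $u\in GSBD^2(\Omega)$, the conditions $\sup_{\varepsilon>0}\mathcal F\big(\frac1\varepsilon(y_\varepsilon-\mathbf{id})\big)<\infty$ and $\frac1\varepsilon(y_\varepsilon-\mathbf{id})\to u$ in measure on $\Omega$ imply that $u$ satisfies (CC). -/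

import Mathlib

open MeasureTheory Set Filter Topology
open scoped ENNReal ContDiff

noncomputable section

/-- The Euclidean plane. -/
abbrev Plane : Type := EuclideanSpace ℝ (Fin 2)

/-! The notions of this section are used for `X = ℝ` and `X = Plane` with Lebesgue measure. -/

section General

variable {X : Type*} [NormedAddCommGroup X] [InnerProductSpace ℝ X] [MeasureSpace X]
variable {F : Type*} [NormedAddCommGroup F]

/-- `a` is the approximate limit of `f z` as `z → x` with `z ∈ S`: for every `δ > 0` the set of
`z ∈ S` with `|f z - a| > δ` has density zero at `x`. -/
def HasApLim (S : Set X) (f : X → F) (x : X) (a : F) : Prop :=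
  ∀ δ : ℝ, 0 < δ →
    Tendsto (fun ρ : ℝ => volume (Metric.ball x ρ ∩ S ∩ {z | δ < ‖f z - a‖}) /
      volume (Metric.ball x ρ)) (𝓝[>] 0) (𝓝 0)

/-- `x` is an approximate jump point of `f : Ω → F` with unit normal `ν`, trace `a = f⁺` on the
side `(z - x) · ν > 0` and trace `b = f⁻ ≠ a` on the side `(z - x) · ν < 0`. -/
structure IsJumpPoint (Ω : Set X) (f : X → F) (x : X) (a b : F) (ν : X) : Prop where
  mem : x ∈ Ω
  norm_normal : ‖ν‖ = 1
  ne : a ≠ b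
  pos : HasApLim (Ω ∩ {z | 0 < inner ℝ (z - x) ν}) f x a
  neg : HasApLim (Ω ∩ {z | inner ℝ (z - x) ν < 0}) f x b

/-- The set `J_f` of approximate jump points of `f : Ω → F`. -/
def jumpSet (Ω : Set X) (f : X → F) : Set X :=
  {x | ∃ (a b : F) (ν : X), IsJumpPoint Ω f x a b ν}

/-- `v ∈ BV_loc(U)` and its distributional derivative is `Dv = σ μ` with `|σ| = 1` `μ`-a.e. on `U`
and `μ` a Borel measure on `U` that is finite on compact subsets of `U` (polar decomposition).
In particular `|Dv|` is the restriction of `μ` to `U`. -/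
structure HasBVDeriv (U : Set X) (v : X → ℝ) (σ : X → X) (μ : Measure X) : Prop where
  locInt : LocallyIntegrableOn v U volume
  finite_on_compacts : ∀ K : Set X, IsCompact K → K ⊆ U → μ K < ⊤
  meas : AEStronglyMeasurable σ (μ.restrict U)
  polar : ∀ᵐ x ∂(μ.restrict U), ‖σ x‖ = 1
  parts : ∀ φ : X → ℝ, ContDiff ℝ ∞ φ → HasCompactSupport φ → tsupport φ ⊆ U → ∀ e : X,
    ∫ x in U, v x * fderiv ℝ φ x e = - ∫ x in U, φ x * inner ℝ (σ x) e ∂μ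

/-- `v ∈ SBV_loc(U)` with `Dv = σ μ` (polar decomposition): outside the jump set of `v`, the
measure `|Dv|` is absolutely continuous with respect to the Lebesgue measure, i.e. the Cantor part
of `Dv` vanishes. -/
def HasSBVDeriv (U : Set X) (v : X → ℝ) (σ : X → X) (μ : Measure X) : Prop :=
  HasBVDeriv U v σ μ ∧ ∀ A : Set X, A ⊆ U \ jumpSet U v → volume A = 0 → μ A = 0

/-- `v ∈ SBV_loc(U)`. -/
def IsSBVLoc (U : Set X) (v : X → ℝ) : Prop :=
  ∃ (σ : X → X) (μ : Measure X), HasSBVDeriv U v σ μ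

/-- The jump points of a scalar function at which the jump has modulus at least one. -/
def largeJumpSet (U : Set X) (v : X → ℝ) : Set X :=
  {x | ∃ (a b : ℝ) (ν : X), IsJumpPoint U v x a b ν ∧ 1 ≤ |a - b|}

end General

/-! Approximate derivatives -/

/-- The function `f : Ω → ℝ²` is approximately differentiable at `x` with approximate gradient `L`;
the value of `f` at `x` is understood as the approximate limit `a` of `f` at `x`. -/
def HasApproxGradAt (Ω : Set Plane) (f : Plane → Plane) (L : Plane →L[ℝ] Plane) (x : Plane) :
    Prop :=
  ∃ a : Plane, HasApLim Ω f x a ∧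
    HasApLim Ω (fun z => ‖z - x‖⁻¹ • (f z - a - L (z - x))) x 0

open Classical in
/-- The approximate gradient `∇f` (zero where `f` is not approximately differentiable). -/
def approxGrad (Ω : Set Plane) (f : Plane → Plane) (x : Plane) : Plane →L[ℝ] Plane :=
  if h : ∃ L, HasApproxGradAt Ω f L x then h.choose else 0

/-- `S` is the approximate symmetric gradient of `f : Ω → ℝ²` at `x`. -/
def HasApproxSymGradAt (Ω : Set Plane) (f : Plane → Plane) (S : Plane →L[ℝ] Plane) (x : Plane) :
    Prop :=
  (∀ v w : Plane, inner ℝ (S v) w = inner ℝ v (S w)) ∧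
  ∃ a : Plane, HasApLim Ω f x a ∧
    HasApLim Ω (fun z => inner ℝ (f z - a - S (z - x)) (z - x) / ‖z - x‖ ^ 2) x 0

open Classical in
/-- The approximate symmetric gradient `e(f)` (zero where it does not exist). -/
def approxSymGrad (Ω : Set Plane) (f : Plane → Plane) (x : Plane) : Plane →L[ℝ] Plane :=
  if h : ∃ S, HasApproxSymGradAt Ω f S x then h.choose else 0

/-! Function spaces -/

/-- `y ∈ GSBV(Ω; ℝ²)`: `y` is measurable and `ψ ∘ y ∈ SBV_loc(Ω)` for every `ψ ∈ C¹(ℝ²)` such that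
`∇ψ` has compact support. -/
def IsGSBV (Ω : Set Plane) (y : Plane → Plane) : Prop :=
  AEStronglyMeasurable y (volume.restrict Ω) ∧
  ∀ ψ : Plane → ℝ, ContDiff ℝ 1 ψ → HasCompactSupport (fderiv ℝ ψ) → IsSBVLoc Ω (ψ ∘ y)

/-- `y ∈ GSBV²(Ω; ℝ²)`: `y ∈ GSBV`, `∇y ∈ L²` and `H¹(J_y) < ∞`. -/
def IsGSBV2 (Ω : Set Plane) (y : Plane → Plane) : Prop :=
  IsGSBV Ω y ∧ MemLp (approxGrad Ω y) 2 (volume.restrict Ω) ∧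
    Measure.hausdorffMeasure 1 (jumpSet Ω y) < ⊤

/-- The line `Π^ξ` through the origin orthogonal to `ξ`. -/
def orthLine (ξ : Plane) : Set Plane := {w | inner ℝ w ξ = 0}

/-- The slice `B^ξ_w = {t : w + t ξ ∈ B}`. -/
def sliceSet (B : Set Plane) (ξ w : Plane) : Set ℝ := {t | w + t • ξ ∈ B}

/-- The sliced function `t ↦ u(w + t ξ) · ξ`. -/
def sliceFun (u : Plane → Plane) (ξ w : Plane) : ℝ → ℝ := fun t => inner ℝ (u (w + t • ξ)) ξ

/-- `u ∈ GSBD(Ω)`: `u` is measurable and there is a finite Borel measure `Λ` such that for every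
direction `ξ` almost every slice `û = sliceFun u ξ w` is in `SBV_loc(Ω^ξ_w)` and, writing
`J¹` for the jump points of `û` with jump of modulus at least one,
`∫_{Π^ξ} (|Dû|(B^ξ_w \ J¹) + H⁰(B^ξ_w ∩ J¹)) dH¹(w) ≤ Λ(B)` for all Borel `B ⊆ Ω`.
Here `m w = |Dû|` is the variation measure of the slice through `w`. -/
def IsGSBD (Ω : Set Plane) (u : Plane → Plane) : Prop :=
  AEStronglyMeasurable u (volume.restrict Ω) ∧
  ∃ Λ : Measure Plane, IsFiniteMeasure Λ ∧ ∀ ξ : Plane, ‖ξ‖ = 1 →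
    ∃ m : Plane → Measure ℝ,
      (∀ᵐ w ∂((Measure.hausdorffMeasure 1).restrict (orthLine ξ)),
        ∃ σ : ℝ → ℝ, HasSBVDeriv (sliceSet Ω ξ w) (sliceFun u ξ w) σ (m w)) ∧
      ∀ B : Set Plane, MeasurableSet B → B ⊆ Ω →
        ∫⁻ w in orthLine ξ,
          (m w (sliceSet B ξ w \ largeJumpSet (sliceSet Ω ξ w) (sliceFun u ξ w)) +
            ((sliceSet B ξ w ∩ largeJumpSet (sliceSet Ω ξ w) (sliceFun u ξ w)).encard : ℝ≥0∞))
          ∂(Measure.hausdorffMeasure 1) ≤ Λ B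

/-- `u ∈ GSBD²(Ω)`: `u ∈ GSBD`, `e(u) ∈ L²` and `H¹(J_u) < ∞`. -/
def IsGSBD2 (Ω : Set Plane) (u : Plane → Plane) : Prop :=
  IsGSBD Ω u ∧ MemLp (approxSymGrad Ω u) 2 (volume.restrict Ω) ∧
    Measure.hausdorffMeasure 1 (jumpSet Ω u) < ⊤

/-! Energy, Ciarlet–Nečas condition, contact condition -/

/-- The linearized Griffith energy `‖e(u)‖²_{L²(Ω)} + H¹(J_u)` (with the Frobenius norm). -/
def linEnergy (Ω : Set Plane) (u : Plane → Plane) : ℝ≥0∞ :=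
  (∫⁻ x in Ω, ∑ i : Fin 2, ‖approxSymGrad Ω u x (EuclideanSpace.single i 1)‖ₑ ^ 2) +
    Measure.hausdorffMeasure 1 (jumpSet Ω u)

open Classical in
/-- The map `y_d`: the approximate limit of `y` at points of approximate differentiability in `Ω`,
and `0` elsewhere. -/
def approxDiffRep (Ω : Set Plane) (y : Plane → Plane) (x : Plane) : Plane :=
  if h : (x ∈ Ω ∧ ∃ L, HasApproxGradAt Ω y L x) ∧ ∃ a, HasApLim Ω y x a then h.2.choose else 0

/-- The measure theoretic image `[y(E)]`. -/
def mtImage (Ω : Set Plane) (y : Plane → Plane) (E : Set Plane) : Set Plane :=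
  approxDiffRep Ω y '' E

/-- The Ciarlet–Nečas non-interpenetration condition: `det ∇y > 0` a.e. in `Ω` and
`∫_Ω det ∇y dx ≤ |[y(Ω)]|`. -/
def CiarletNecas (Ω : Set Plane) (y : Plane → Plane) : Prop :=
  (∀ᵐ x ∂(volume.restrict Ω), 0 < (approxGrad Ω y x).det) ∧
    ∫⁻ x in Ω, ENNReal.ofReal (approxGrad Ω y x).det ≤ volume (mtImage Ω y Ω)

/-- The contact condition: `ν_u · [u] ≥ 0` at `H¹`-almost every point of `J_u`, `[u] = u⁺ - u⁻`. -/
def ContactCondition (Ω : Set Plane) (u : Plane → Plane) : Prop :=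
  ∀ᵐ x ∂(Measure.hausdorffMeasure 1 : Measure Plane), x ∈ jumpSet Ω u →
    ∀ (a b ν : Plane), IsJumpPoint Ω u x a b ν → 0 ≤ inner ℝ ν (a - b)

/-- The rescaled displacement `(y - id) / ε`. -/
def rescaledDisp (ε : ℝ) (y : Plane → Plane) : Plane → Plane := fun x => ε⁻¹ • (y x - x)

/-! The data of the example -/

/-- The square `(-1,1)²`. -/
def openSquare : Set Plane := {x | ∀ i, x i ∈ Ioo (-1 : ℝ) 1}

/-- The first unit vector. -/
def e₁ : Plane := !₂[1, 0]

/-- `u = (-1,0) χ_{x₁ > 0}`. -/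
def limitDisp : Plane → Plane := indicator {x | 0 < x 0} (fun _ => !₂[-1, 0])

/-- `u_ε = (-1,0) χ_{x₁ > 0} + (2/ε,0) χ_{-2ε < x₁ < 0}`. -/
def seqDisp (ε : ℝ) : Plane → Plane := fun x =>
  indicator {x : Plane | 0 < x 0} (fun _ => !₂[-1, 0]) x +
    indicator {x : Plane | -(2 * ε) < x 0 ∧ x 0 < 0} (fun _ => !₂[2 / ε, 0]) x

/-- `y_ε = id + ε u_ε`. -/
def seqDef (ε : ℝ) : Plane → Plane := fun x => x + ε • seqDisp ε x

end

/-! ### Approximate limits and jump points -/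

section ApproximateLimits

variable {X : Type*} [NormedAddCommGroup X] [MeasureSpace X]
variable {F : Type*} [NormedAddCommGroup F]

/-! The Ciarlet–Nečas condition only sees whether images overlap, so a thin layer of material may be
thrown far away to make room. The map `seqDef ε` fixes the points with `z 0 < -2ε`, throws the strip
`-2ε < z 0 < 0` by 2 to the right, beyond the square, and pushes the right half to the left by `ε`
into the room just vacated. The three images are disjoint, so the map is injective off two vertical
lines. Its gradient is the identity almost everywhere, and the area formula gives (CN).

After division by `ε`, the displacement differs from `limitDisp` only on a strip of width `2ε`,
which disappears in measure although the values there blow up. The energy consists of the lengths of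
at most two chords of length 2. What survives in the limit is the push of the right half against the
left one, a jump with `ν · [u] = -1`.

The rest is the verification of the function space definitions. Approximate limits are handled by
`HasApLim.false_of_cone`: an open cone has positive density at its vertex, which gives uniqueness of
traces, of approximate gradients and of symmetric gradients, as well as the form of the jump normal.
Membership in GSBV comes from `isSBVLoc_piecewise`: composing a smooth function with a piecewise
affine map gives a piecewise `C¹` function, whose derivative is found by integrating by parts on
half planes. Membership in GSBD comes from slicing: every slice of `limitDisp` is a step function
with at most one jump (`hasSBVDeriv_stepFun`, `slice_variation_le`). -/

theorem HasApLim.of_tendsto {S : Set X} {f : X → F} {x : X} {a : F}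
    (h : Tendsto f (𝓝[S] x) (𝓝 a)) : HasApLim S f x a := by
  intro δ hδ
  have h1 : ∀ᶠ z in 𝓝 x, z ∈ S → ‖f z - a‖ < δ := by
    rw [← eventually_nhdsWithin_iff]
    filter_upwards [h (Metric.ball_mem_nhds a hδ)] with z hz
    simpa [dist_eq_norm] using hz
  obtain ⟨r, hr, hrs⟩ := Metric.eventually_nhds_iff_ball.1 h1
  refine tendsto_const_nhds.congr' ?_
  filter_upwards [Ioo_mem_nhdsGT hr] with ρ hρ
  have : Metric.ball x ρ ∩ S ∩ {z | δ < ‖f z - a‖} = ∅ := by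
    ext z
    simp only [mem_inter_iff, mem_ofPred_eq, mem_empty_iff_false, iff_false]
    rintro ⟨⟨hz, hzS⟩, hlt⟩
    exact absurd hlt (not_lt.2 (hrs z (Metric.ball_subset_ball hρ.2.le hz) hzS).le)
  rw [this]
  simp

theorem HasApLim.of_eventuallyEq {S : Set X} {f : X → F} {x : X} {a : F}
    (h : ∀ᶠ z in 𝓝 x, f z = a) : HasApLim S f x a :=
  HasApLim.of_tendsto ((tendsto_const_nhds.congr'
    (by filter_upwards [h] with z hz using hz.symm)).mono_left nhdsWithin_le_nhds)

variable [InnerProductSpace ℝ X]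

theorem IsJumpPoint.of_tendsto {Ω : Set X} {f : X → F} {x ν : X} {a b : F} (hx : x ∈ Ω)
    (hν : ‖ν‖ = 1) (hab : a ≠ b)
    (hpos : Tendsto f (𝓝[{z | 0 < inner ℝ (z - x) ν}] x) (𝓝 a))
    (hneg : Tendsto f (𝓝[{z | inner ℝ (z - x) ν < 0}] x) (𝓝 b)) : IsJumpPoint Ω f x a b ν where
  mem := hx
  norm_normal := hν
  ne := hab
  pos := HasApLim.of_tendsto (hpos.mono_left (nhdsWithin_mono _ inter_subset_right))
  neg := HasApLim.of_tendsto (hneg.mono_left (nhdsWithin_mono _ inter_subset_right))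

variable [FiniteDimensional ℝ X] [BorelSpace X] [(volume : Measure X).IsAddHaarMeasure]

/-- An open cone has positive density at its vertex. -/
theorem HasApLim.false_of_cone {S : Set X} {f : X → F} {x : X} {a : F} (h : HasApLim S f x a)
    {C : Set X} (hC : IsOpen C) (hne : C.Nonempty)
    (hcone : ∀ r : ℝ, 0 < r → ∀ z ∈ C, r • z ∈ C) {δ : ℝ} (hδ : 0 < δ)
    (hev : ∀ᶠ z in 𝓝 x, z - x ∈ C → z ∈ S ∧ δ < ‖f z - a‖) : False := by
  have hball : ∀ ρ : ℝ, 0 < ρ →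
      Metric.ball x ρ = AffineMap.homothety x ρ '' Metric.ball x 1 := by
    intro ρ hρ
    ext z
    simp only [AffineMap.homothety_apply, mem_image, Metric.mem_ball, dist_eq_norm, vsub_eq_sub,
      vadd_eq_add]
    constructor
    · intro hz
      refine ⟨x + ρ⁻¹ • (z - x), ?_, ?_⟩
      · rw [add_sub_cancel_left, norm_smul, norm_inv, Real.norm_of_nonneg hρ.le,
          inv_mul_lt_iff₀ hρ]
        simpa using hz
      · rw [add_sub_cancel_left, smul_inv_smul₀ hρ.ne']
        abel
    · rintro ⟨y, hy, rfl⟩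
      rw [add_sub_cancel_right, norm_smul, Real.norm_of_nonneg hρ.le]
      nlinarith
  have hcball : ∀ ρ : ℝ, 0 < ρ → Metric.ball x ρ ∩ {z | z - x ∈ C} =
      AffineMap.homothety x ρ '' (Metric.ball x 1 ∩ {z | z - x ∈ C}) := by
    intro ρ hρ
    have hinj : Function.Injective (AffineMap.homothety x ρ : X → X) := by
      intro y y' hy
      simpa [AffineMap.homothety_apply, hρ.ne'] using hy
    rw [image_inter hinj, ← hball ρ hρ]
    congr 1
    ext z
    simp only [AffineMap.homothety_apply, mem_image, vsub_eq_sub, vadd_eq_add, mem_ofPred_eq]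
    constructor
    · intro hz
      refine ⟨x + ρ⁻¹ • (z - x), ?_, ?_⟩
      · rw [add_sub_cancel_left]
        exact hcone _ (inv_pos.2 hρ) _ hz
      · rw [add_sub_cancel_left, smul_inv_smul₀ hρ.ne']
        abel
    · rintro ⟨y, hy, rfl⟩
      rw [add_sub_cancel_right]
      exact hcone _ hρ _ hy
  -- By homothety the cone fills the same fraction `k` of every ball centred at its vertex. The
  -- density in the definition of the approximate limit thus stays above `k > 0`.
  set k : ℝ≥0∞ := volume (Metric.ball x 1 ∩ {z | z - x ∈ C}) / volume (Metric.ball x 1) with hk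
  have hkpos : k ≠ 0 := by
    refine (ENNReal.div_pos ?_ measure_ball_lt_top.ne).ne'
    refine (IsOpen.measure_pos volume (Metric.isOpen_ball.inter
      (hC.preimage (continuous_id.sub continuous_const))) ?_).ne'
    obtain ⟨c, hc⟩ := hne
    have hpos : 0 < (‖c‖ + 1)⁻¹ := by positivity
    refine ⟨x + (‖c‖ + 1)⁻¹ • c, ?_, ?_⟩
    · rw [Metric.mem_ball, dist_eq_norm, add_sub_cancel_left, norm_smul,
        Real.norm_of_nonneg hpos.le, inv_mul_lt_iff₀ (by positivity)]
      linarith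
    · simpa using hcone _ hpos _ hc
  have hratio : ∀ᶠ ρ : ℝ in 𝓝[>] 0, k ≤
      volume (Metric.ball x ρ ∩ S ∩ {z | δ < ‖f z - a‖}) / volume (Metric.ball x ρ) := by
    obtain ⟨r, hr, hrs⟩ := Metric.eventually_nhds_iff_ball.1 hev
    filter_upwards [Ioo_mem_nhdsGT hr] with ρ hρ
    have h0 : ENNReal.ofReal |ρ ^ Module.finrank ℝ X| ≠ 0 := by
      simp [hρ.1.ne']
    calc k = volume (Metric.ball x ρ ∩ {z | z - x ∈ C}) / volume (Metric.ball x ρ) := by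
          rw [hcball ρ hρ.1, hball ρ hρ.1, Measure.addHaar_image_homothety,
            Measure.addHaar_image_homothety, ENNReal.mul_div_mul_left _ _ h0 ENNReal.ofReal_ne_top]
      _ ≤ _ := by
          refine ENNReal.div_le_div_right (measure_mono ?_) _
          rintro z ⟨hz, hzC⟩
          have := hrs z (Metric.ball_subset_ball hρ.2.le hz) hzC
          exact ⟨⟨hz, this.1⟩, this.2⟩
  exact hkpos (nonpos_iff_eq_zero.1 (ge_of_tendsto (h δ hδ) hratio))

/-- If `a ≠ l`, the values of `f` on the cone are eventually farther than `‖l - a‖ / 2` from `a`, on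
a set of positive density. One cone inside `S` suffices; `f` need not converge on the rest of `S`.
-/
theorem HasApLim.eq_of_tendsto {S : Set X} {f : X → F} {x : X} {a l : F} (h : HasApLim S f x a)
    {C : Set X} (hC : IsOpen C) (hne : C.Nonempty)
    (hcone : ∀ r : ℝ, 0 < r → ∀ z ∈ C, r • z ∈ C) (hS : ∀ᶠ z in 𝓝 x, z - x ∈ C → z ∈ S)
    (hl : Tendsto f (𝓝[{z | z - x ∈ C}] x) (𝓝 l)) : a = l := by
  by_contra hal
  have hpos : 0 < ‖l - a‖ := norm_pos_iff.2 (sub_ne_zero.2 (Ne.symm hal))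
  have hlim : Tendsto (fun z => ‖f z - a‖) (𝓝[{z | z - x ∈ C}] x) (𝓝 ‖l - a‖) :=
    (hl.sub_const a).norm
  have hev := hlim.eventually_const_lt (half_lt_self hpos)
  rw [eventually_nhdsWithin_iff] at hev
  refine h.false_of_cone hC hne hcone (half_pos hpos) ?_
  filter_upwards [hS, hev] with z h1 h2 hz using ⟨h1 hz, h2 hz⟩

theorem HasApLim.eq_of_continuousAt {S : Set X} {f : X → F} {x : X} {a : F}
    (h : HasApLim S f x a) (hS : S ∈ 𝓝 x) (hf : ContinuousAt f x) : a = f x :=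
  h.eq_of_tendsto (C := univ) isOpen_univ univ_nonempty (by simp)
    (by filter_upwards [hS] with z hz _ using hz) (by simpa using hf.tendsto)

/-- The half spaces on both sides of a hyperplane through `x` are open cones, so both traces would
equal `f x`. -/
theorem notMem_jumpSet_of_continuousAt {Ω : Set X} (hΩ : IsOpen Ω) {f : X → F} {x : X}
    (hf : ContinuousAt f x) : x ∉ jumpSet Ω f := by
  rintro ⟨a, b, ν, h⟩
  have hΩx := hΩ.mem_nhds h.mem
  have hν : (0 : ℝ) < inner ℝ ν ν := by
    rw [real_inner_self_eq_norm_sq, h.norm_normal]; norm_num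
  have hcont : Continuous fun z : X => inner ℝ z ν := by fun_prop
  refine h.ne (Eq.trans (b := f x) ?_ (Eq.symm ?_))
  · refine h.pos.eq_of_tendsto (C := {z | 0 < inner ℝ z ν}) (isOpen_lt continuous_const hcont)
      ⟨ν, hν⟩ ?_ ?_ (hf.tendsto.mono_left nhdsWithin_le_nhds)
    · intro r hr z hz
      simp only [mem_ofPred_eq, real_inner_smul_left] at hz ⊢
      positivity
    · filter_upwards [hΩx] with z hz hzC using ⟨hz, hzC⟩
  · refine h.neg.eq_of_tendsto (C := {z | inner ℝ z ν < 0}) (isOpen_lt hcont continuous_const)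
      ⟨-ν, by simpa using hν⟩ ?_ ?_ (hf.tendsto.mono_left nhdsWithin_le_nhds)
    · intro r hr z hz
      simp only [mem_ofPred_eq, real_inner_smul_left] at hz ⊢
      exact mul_neg_of_pos_of_neg hr hz
    · filter_upwards [hΩx] with z hz hzC using ⟨hz, hzC⟩

end ApproximateLimits

/-! ### Approximate gradients of locally affine maps -/

section ApproximateGradients

theorem hasApproxGradAt_of_eventuallyEq {Ω : Set Plane} {f : Plane → Plane} {x c : Plane}
    {L : Plane →L[ℝ] Plane} (hf : ∀ᶠ z in 𝓝 x, f z = L z + c) : HasApproxGradAt Ω f L x := by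
  refine ⟨L x + c, HasApLim.of_tendsto ?_, HasApLim.of_eventuallyEq ?_⟩
  · have : Tendsto (fun z => L z + c) (𝓝 x) (𝓝 (L x + c)) :=
      (L.continuous.add continuous_const).tendsto x
    exact (this.congr' (by filter_upwards [hf] with z hz using hz.symm)).mono_left
      nhdsWithin_le_nhds
  · filter_upwards [hf] with z hz
    rw [hz, map_sub]
    simp

/-- With `M = L - L'`, the difference quotient at `z` is `‖M (z - x)‖ / ‖z - x‖`, homogeneous of
degree zero in `z - x`. If `M v ≠ 0` it stays away from zero on an open cone around `v`. -/
theorem HasApproxGradAt.eq_of_eventuallyEq {Ω : Set Plane} {f : Plane → Plane} {x c : Plane}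
    {L L' : Plane →L[ℝ] Plane} (hΩ : Ω ∈ 𝓝 x) (hf : ∀ᶠ z in 𝓝 x, f z = L z + c)
    (h : HasApproxGradAt Ω f L' x) : L' = L := by
  obtain ⟨a, ha, hL⟩ := h
  have hcont : ContinuousAt f x :=
    (L.continuous.add continuous_const).continuousAt.congr
      (by filter_upwards [hf] with z hz using hz.symm)
  have hax : a = L x + c := (ha.eq_of_continuousAt hΩ hcont).trans hf.self_of_nhds
  by_contra hne
  obtain ⟨v, hv⟩ : ∃ v, (L - L') v ≠ 0 := by
    by_contra! hall
    exact hne (sub_eq_zero.1 (ContinuousLinearMap.ext hall)).symm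
  set M := L - L' with hM
  have hv0 : v ≠ 0 := by rintro rfl; simp at hv
  -- Half of the quotient at `v`: the strict inequality then holds at `v` and defines an open cone.
  have hδ : 0 < ‖M v‖ / (2 * ‖v‖) := by positivity
  refine hL.false_of_cone (C := {z | ‖M v‖ / (2 * ‖v‖) * ‖z‖ < ‖M z‖})
    (isOpen_lt (by fun_prop) (by fun_prop)) ⟨v, ?_⟩ ?_ hδ ?_
  · have : 0 < ‖M v‖ := norm_pos_iff.2 hv
    have h2 : ‖M v‖ / (2 * ‖v‖) * ‖v‖ = ‖M v‖ / 2 := by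
      have := norm_pos_iff.2 hv0
      field_simp
    rw [mem_ofPred_eq, h2]
    linarith
  · intro r hr z hz
    simp only [mem_ofPred_eq, map_smul, norm_smul, Real.norm_of_nonneg hr.le] at hz ⊢
    nlinarith
  · filter_upwards [hf, hΩ] with z hz hzΩ hzC
    refine ⟨hzΩ, ?_⟩
    have hz0 : 0 < ‖z - x‖ := by
      rw [norm_pos_iff]
      rintro h0
      rw [h0] at hzC
      simp at hzC
    have : f z - a - L' (z - x) = M (z - x) := by
      rw [hz, hax, hM, sub_apply, map_sub L]
      abel
    rw [sub_zero, this, norm_smul, norm_inv, norm_norm, inv_mul_eq_div, lt_div_iff₀ hz0]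
    exact hzC

theorem approxGrad_eq_of_eventuallyEq {Ω : Set Plane} {f : Plane → Plane} {x c : Plane}
    {L : Plane →L[ℝ] Plane} (hΩ : Ω ∈ 𝓝 x) (hf : ∀ᶠ z in 𝓝 x, f z = L z + c) :
    approxGrad Ω f x = L := by
  have hex : ∃ L, HasApproxGradAt Ω f L x := ⟨L, hasApproxGradAt_of_eventuallyEq hf⟩
  rw [approxGrad, dif_pos hex]
  exact hex.choose_spec.eq_of_eventuallyEq hΩ hf

/-- The cone argument applied to the quadratic form of a candidate `S` shows that this form
vanishes, and a symmetric operator with vanishing quadratic form is zero. -/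
theorem approxSymGrad_eq_zero_of_eventuallyEq {Ω : Set Plane} {f : Plane → Plane} {x c : Plane}
    (hΩ : Ω ∈ 𝓝 x) (hf : ∀ᶠ z in 𝓝 x, f z = c) : approxSymGrad Ω f x = 0 := by
  rw [approxSymGrad]
  -- Existence of a symmetric gradient need not be proved, since the default value is also zero.
  split_ifs with hex
  swap
  · rfl
  obtain ⟨hsym, a, ha, hS⟩ := hex.choose_spec
  set S := hex.choose
  have hcont : ContinuousAt f x :=
    continuousAt_const.congr (by filter_upwards [hf] with z hz using hz.symm)
  have hax : a = c := (ha.eq_of_continuousAt hΩ hcont).trans hf.self_of_nhds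
  have hquad : ∀ v, inner ℝ (S v) v = 0 := by
    intro v
    by_contra hv
    have hv0 : v ≠ 0 := by rintro rfl; simp at hv
    have hpos : 0 < |inner ℝ (S v) v| := abs_pos.2 hv
    have hδ : 0 < |inner ℝ (S v) v| / (2 * ‖v‖ ^ 2) := by positivity
    refine hS.false_of_cone (C := {z | |inner ℝ (S v) v| / (2 * ‖v‖ ^ 2) * ‖z‖ ^ 2 <
      |inner ℝ (S z) z|}) (isOpen_lt (by fun_prop) (by fun_prop)) ⟨v, ?_⟩ ?_ hδ ?_
    · have h2 : |inner ℝ (S v) v| / (2 * ‖v‖ ^ 2) * ‖v‖ ^ 2 = |inner ℝ (S v) v| / 2 := by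
        have := norm_pos_iff.2 hv0
        field_simp
      rw [mem_ofPred_eq, h2]
      linarith
    · intro r hr z hz
      simp only [mem_ofPred_eq, map_smul, norm_smul, Real.norm_of_nonneg hr.le,
        real_inner_smul_left, real_inner_smul_right, abs_mul, abs_of_pos hr] at hz ⊢
      have := mul_lt_mul_of_pos_left hz (mul_pos hr hr)
      linarith
    · filter_upwards [hf, hΩ] with z hz hzΩ hzC
      refine ⟨hzΩ, ?_⟩
      have hz0 : 0 < ‖z - x‖ := by
        rw [norm_pos_iff]
        rintro h0
        rw [h0] at hzC
        simp at hzC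
      rw [sub_zero, hz, hax, sub_self, zero_sub, inner_neg_left, Real.norm_eq_abs, abs_div,
        abs_neg, abs_of_pos (pow_pos hz0 2), lt_div_iff₀ (pow_pos hz0 2)]
      exact hzC
  have hT : (S : Plane →ₗ[ℝ] Plane).IsSymmetric := fun v w => hsym v w
  have := hT.inner_map_self_eq_zero.1 hquad
  ext1 v
  exact LinearMap.congr_fun this v

end ApproximateGradients

/-! ### Polar decomposition of a vector density -/

section Polar

variable {X : Type*} [NormedAddCommGroup X] [InnerProductSpace ℝ X] [MeasureSpace X]
  [BorelSpace X] [SecondCountableTopology X]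

/-- If the distributional derivative of `v` is `G m`, then its polar decomposition is
`(G / |G|) (|G| m)`. -/
theorem hasSBVDeriv_of_density {U : Set X} (hU : IsOpen U) {v : X → ℝ} {G : X → X}
    {m : Measure X} (hG : Measurable G) (hm : ∀ K : Set X, IsCompact K → m K < ⊤)
    (hbd : ∀ K : Set X, IsCompact K → ∃ c : ℝ, ∀ x ∈ K, ‖G x‖ ≤ c)
    (hv : LocallyIntegrableOn v U volume)
    (parts : ∀ φ : X → ℝ, ContDiff ℝ ∞ φ → HasCompactSupport φ → tsupport φ ⊆ U → ∀ e : X,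
      ∫ x in U, v x * fderiv ℝ φ x e = - ∫ x in U, φ x * inner ℝ (G x) e ∂m)
    (hnull : ∀ A : Set X, A ⊆ U \ jumpSet U v → volume A = 0 → ∀ᵐ x ∂m, G x ≠ 0 → x ∉ A) :
    HasSBVDeriv U v (fun x => ‖G x‖⁻¹ • G x) (m.withDensity fun x => ‖G x‖ₑ) := by
  have hGe : Measurable fun x => ‖G x‖ₑ := hG.enorm
  refine ⟨⟨hv, ?_, ?_, ?_, ?_⟩, ?_⟩
  · intro K hK _
    obtain ⟨c, hc⟩ := hbd K hK
    rw [withDensity_apply _ hK.measurableSet]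
    calc ∫⁻ x in K, ‖G x‖ₑ ∂m ≤ ∫⁻ _ in K, ENNReal.ofReal c ∂m := by
          refine setLIntegral_mono measurable_const fun x hx => ?_
          rw [← ofReal_norm]
          exact ENNReal.ofReal_le_ofReal (hc x hx)
      _ < ⊤ := by
          rw [setLIntegral_const]
          exact ENNReal.mul_lt_top ENNReal.ofReal_lt_top (hm K hK)
  · exact (hG.norm.inv.smul hG).aestronglyMeasurable
  · refine ae_restrict_of_ae ((ae_withDensity_iff hGe).2 (Eventually.of_forall fun x hx => ?_))
    have : ‖G x‖ ≠ 0 := by simpa using hx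
    rw [norm_smul, norm_inv, norm_norm, inv_mul_cancel₀ this]
  · intro φ h1 h2 h3 e
    rw [parts φ h1 h2 h3 e]
    have := setIntegral_withDensity_eq_setIntegral_smul (μ := m) hG.nnnorm
      (fun x => φ x * inner ℝ (‖G x‖⁻¹ • G x) e) hU.measurableSet
    simp only [enorm_eq_nnnorm]
    rw [this]
    congr 1
    refine integral_congr_ae (Eventually.of_forall fun x => ?_)
    simp only [NNReal.smul_def, coe_nnnorm, smul_eq_mul, real_inner_smul_left]
    by_cases hx : ‖G x‖ = 0
    · simp [norm_eq_zero.1 hx]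
    · field_simp
  · intro A hA hA0
    have : ∀ᵐ x ∂(m.withDensity fun x => ‖G x‖ₑ), x ∉ A := by
      rw [ae_withDensity_iff hGe]
      filter_upwards [hnull A hA hA0] with x hx hx0
      exact hx (by simpa using hx0)
    simpa [ae_iff] using this

end Polar

/-! ### Coordinates on the plane -/

section Coordinates

theorem inner_e₁_right (z : Plane) : inner ℝ z e₁ = z 0 := by
  simp [e₁, PiLp.inner_apply, Fin.sum_univ_two]

theorem norm_e₁ : ‖e₁‖ = 1 := by
  simp [e₁, EuclideanSpace.norm_eq, Fin.sum_univ_two]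

theorem measurePreserving_plane_mk :
    MeasurePreserving (fun p : ℝ × ℝ => (!₂[p.1, p.2] : Plane)) :=
  (PiLp.volume_preserving_toLp (Fin 2)).comp (volume_preserving_finTwoArrow ℝ).symm

theorem measurableEmbedding_plane_mk :
    MeasurableEmbedding (fun p : ℝ × ℝ => (!₂[p.1, p.2] : Plane)) :=
  (MeasurableEquiv.toLp 2 (Fin 2 → ℝ)).measurableEmbedding.comp
    (MeasurableEquiv.finTwoArrow (α := ℝ)).symm.measurableEmbedding

theorem isometry_vertical (c : ℝ) : Isometry (fun t : ℝ => (!₂[c, t] : Plane)) := by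
  refine Isometry.of_dist_eq fun s t => ?_
  simp [EuclideanSpace.dist_eq, Fin.sum_univ_two, Real.dist_eq, Real.sqrt_sq_eq_abs]

theorem continuous_coord (i : Fin 2) : Continuous fun z : Plane => z i := by fun_prop

theorem isOpen_halfPlane (c : ℝ) : IsOpen {z : Plane | c < z 0} :=
  isOpen_lt continuous_const (continuous_coord 0)

theorem ae_coord_ne (c : ℝ) : ∀ᵐ z : Plane, z 0 ≠ c := by
  have hm : MeasurableSet {z : Plane | z 0 = c} :=
    (isClosed_eq (continuous_coord 0) continuous_const).measurableSet
  have h := measurePreserving_plane_mk.measure_preimage hm.nullMeasurableSet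
  have h2 : (fun p : ℝ × ℝ => (!₂[p.1, p.2] : Plane)) ⁻¹' {z : Plane | z 0 = c} =
      {c} ×ˢ univ := by
    ext p; simp
  rw [h2, Measure.volume_eq_prod, Measure.prod_prod] at h
  rw [ae_iff]
  simpa using h.symm

/-- The length measure on the vertical line `z₁ = c`. -/
noncomputable def verticalMeasure (c : ℝ) : Measure Plane :=
  Measure.map (fun t : ℝ => (!₂[c, t] : Plane)) volume

theorem ae_verticalMeasure (c : ℝ) : ∀ᵐ z ∂(verticalMeasure c), z 0 = c := by
  rw [verticalMeasure, (isometry_vertical c).isClosedEmbedding.measurableEmbedding.ae_map_iff]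
  simp

theorem integral_verticalMeasure (c : ℝ) (f : Plane → ℝ) :
    ∫ z, f z ∂(verticalMeasure c) = ∫ t : ℝ, f !₂[c, t] :=
  (isometry_vertical c).isClosedEmbedding.measurableEmbedding.integral_map f

theorem verticalMeasure_lt_top (c : ℝ) {K : Set Plane} (hK : IsCompact K) :
    verticalMeasure c K < ⊤ := by
  rw [verticalMeasure, (isometry_vertical c).isClosedEmbedding.measurableEmbedding.map_apply]
  exact ((isometry_vertical c).isClosedEmbedding.isCompact_preimage hK).measure_lt_top

instance (c : ℝ) : IsFiniteMeasureOnCompacts (verticalMeasure c) :=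
  ⟨fun _ hK => verticalMeasure_lt_top c hK⟩

end Coordinates

/-! ### Integration by parts on half planes -/

section HalfPlane

/-- Fubini and the fundamental theorem of calculus on lines: the horizontal derivative leaves the
boundary term on `z 0 = c`, the vertical one integrates to zero. -/
theorem setIntegral_halfPlane_fderiv {F : Plane → ℝ} (hF : ContDiff ℝ 1 F)
    (hc : HasCompactSupport F) (c : ℝ) (e : Plane) :
    ∫ z in {z : Plane | c < z 0}, fderiv ℝ F z e = -(e 0 * ∫ t : ℝ, F !₂[c, t]) := by
  have hpre : (fun p : ℝ × ℝ => (!₂[p.1, p.2] : Plane)) ⁻¹' {z : Plane | c < z 0} =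
      Ioi c ×ˢ univ := by
    ext p; simp
  have hint : ∀ d : Plane, Integrable (fun z => fderiv ℝ F z d) := fun d =>
    ((hF.continuous_fderiv one_ne_zero).clm_apply continuous_const).integrable_of_hasCompactSupport
      (hc.fderiv_apply ℝ d)
  have hint' : ∀ d : Plane, Integrable (fun p : ℝ × ℝ => fderiv ℝ F !₂[p.1, p.2] d)
      ((volume.restrict (Ioi c)).prod volume) := by
    intro d
    have h1 : Integrable (fun p : ℝ × ℝ => fderiv ℝ F !₂[p.1, p.2] d) :=
      (measurePreserving_plane_mk.integrable_comp_emb measurableEmbedding_plane_mk).2 (hint d)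
    have h2 := h1.integrableOn (s := Ioi c ×ˢ univ)
    rwa [IntegrableOn, Measure.volume_eq_prod, ← Measure.prod_restrict, Measure.restrict_univ]
      at h2
  have htransfer : ∀ d : Plane, ∫ z in {z : Plane | c < z 0}, fderiv ℝ F z d =
      ∫ p : ℝ × ℝ, fderiv ℝ F !₂[p.1, p.2] d ∂((volume.restrict (Ioi c)).prod volume) := by
    intro d
    rw [← measurePreserving_plane_mk.setIntegral_preimage_emb measurableEmbedding_plane_mk
      (fun z => fderiv ℝ F z d), hpre, Measure.volume_eq_prod, ← Measure.prod_restrict,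
      Measure.restrict_univ]
  have hd0 : ∀ t s : ℝ, HasDerivAt (fun s : ℝ => (!₂[s, t] : Plane)) !₂[1, 0] s := by
    intro t s
    have h := ((hasDerivAt_id s).smul_const (!₂[1, 0] : Plane)).add_const (!₂[0, t] : Plane)
    rw [one_smul] at h
    refine h.congr_of_eventuallyEq (Eventually.of_forall fun r => ?_)
    ext i; fin_cases i <;> simp
  have hd1 : ∀ s t : ℝ, HasDerivAt (fun t : ℝ => (!₂[s, t] : Plane)) !₂[0, 1] t := by
    intro s t
    have h := ((hasDerivAt_id t).smul_const (!₂[0, 1] : Plane)).add_const (!₂[s, 0] : Plane)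
    rw [one_smul] at h
    refine h.congr_of_eventuallyEq (Eventually.of_forall fun r => ?_)
    ext i; fin_cases i <;> simp
  have hdiff : ∀ z, HasFDerivAt F (fderiv ℝ F z) z := fun z =>
    (hF.differentiable one_ne_zero z).hasFDerivAt
  have hiso : ∀ t : ℝ, Isometry (fun s : ℝ => (!₂[s, t] : Plane)) := fun t => by
    refine Isometry.of_dist_eq fun s s' => ?_
    simp [EuclideanSpace.dist_eq, Fin.sum_univ_two, Real.dist_eq, Real.sqrt_sq_eq_abs]
  have hz : ∫ z in {z : Plane | c < z 0}, fderiv ℝ F z !₂[1, 0] = -∫ t : ℝ, F !₂[c, t] := by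
    rw [htransfer, integral_prod_symm _ (hint' _), ← integral_neg]
    refine integral_congr_ae (Eventually.of_forall fun t => ?_)
    have hderiv : ∀ s, deriv (fun s : ℝ => F !₂[s, t]) s = fderiv ℝ F !₂[s, t] !₂[1, 0] :=
      fun s => ((hdiff _).comp_hasDerivAt s (hd0 t s)).deriv
    have := HasCompactSupport.integral_Ioi_deriv_eq (f := fun s : ℝ => F !₂[s, t])
      (hF.comp (by rw [contDiff_euclidean]; intro i; fin_cases i <;> simp <;> fun_prop))
      (hc.comp_isClosedEmbedding (hiso t).isClosedEmbedding) c
    simpa only [hderiv] using this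
  have ho : ∫ z in {z : Plane | c < z 0}, fderiv ℝ F z !₂[0, 1] = 0 := by
    rw [htransfer, integral_prod _ (hint' _)]
    refine integral_eq_zero_of_ae (Eventually.of_forall fun s => ?_)
    have hs : HasCompactSupport (fun t : ℝ => F !₂[s, t]) :=
      hc.comp_isClosedEmbedding (isometry_vertical s).isClosedEmbedding
    have hs' : ContDiff ℝ 1 (fun t : ℝ => F !₂[s, t]) :=
      hF.comp (by rw [contDiff_euclidean]; intro i; fin_cases i <;> simp <;> fun_prop)
    have hderiv : ∀ t, deriv (fun t : ℝ => F !₂[s, t]) t = fderiv ℝ F !₂[s, t] !₂[0, 1] :=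
      fun t => ((hdiff _).comp_hasDerivAt t (hd1 s t)).deriv
    have := integral_eq_zero_of_hasDerivAt_of_integrable
      (fun t => (hdiff !₂[s, t]).comp_hasDerivAt t (hd1 s t))
      (by
        rw [← funext hderiv]
        exact (hs'.continuous_deriv le_rfl).integrable_of_hasCompactSupport hs.deriv)
      (hs'.continuous.integrable_of_hasCompactSupport hs)
    simpa using this
  have he : e = e 0 • (!₂[1, 0] : Plane) + e 1 • (!₂[0, 1] : Plane) := by
    ext i; fin_cases i <;> simp
  have hsplit : ∀ z, fderiv ℝ F z e =
      e 0 * fderiv ℝ F z !₂[1, 0] + e 1 * fderiv ℝ F z !₂[0, 1] := by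
    intro z
    conv_lhs => rw [he]
    simp
  simp only [hsplit]
  rw [integral_add ((hint _).const_mul _).integrableOn ((hint _).const_mul _).integrableOn,
    integral_const_mul, integral_const_mul, hz, ho]
  ring

theorem integrable_mul_fderiv {h φ : Plane → ℝ} (hh : Continuous h) (hφ : ContDiff ℝ 1 φ)
    (hc : HasCompactSupport φ) (e : Plane) : Integrable fun z => h z * fderiv ℝ φ z e :=
  (hh.mul ((hφ.continuous_fderiv one_ne_zero).clm_apply
    continuous_const)).integrable_of_hasCompactSupport (hc.fderiv_apply ℝ e).mul_left

theorem integrable_mul_fderiv' {h φ : Plane → ℝ} (hh : ContDiff ℝ 1 h) (hφ : Continuous φ)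
    (hc : HasCompactSupport φ) (e : Plane) : Integrable fun z => φ z * fderiv ℝ h z e :=
  (hφ.mul ((hh.continuous_fderiv one_ne_zero).clm_apply
    continuous_const)).integrable_of_hasCompactSupport hc.mul_right

theorem setIntegral_halfPlane_mul_fderiv {h φ : Plane → ℝ} (hh : ContDiff ℝ 1 h)
    (hφ : ContDiff ℝ 1 φ) (hc : HasCompactSupport φ) (c : ℝ) (e : Plane) :
    ∫ z in {z : Plane | c < z 0}, h z * fderiv ℝ φ z e =
      -(∫ z in {z : Plane | c < z 0}, φ z * fderiv ℝ h z e) -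
        e 0 * ∫ t : ℝ, h !₂[c, t] * φ !₂[c, t] := by
  have key := setIntegral_halfPlane_fderiv (hh.mul hφ) hc.mul_left c e
  have hprod : ∀ z, fderiv ℝ (fun z => h z * φ z) z e =
      h z * fderiv ℝ φ z e + φ z * fderiv ℝ h z e := by
    intro z
    rw [fderiv_fun_mul (hh.differentiable one_ne_zero z) (hφ.differentiable one_ne_zero z)]
    simp
  simp only [hprod] at key
  rw [integral_add (integrable_mul_fderiv hh.continuous hφ hc e).integrableOn
    (integrable_mul_fderiv' hh hφ.continuous hc e).integrableOn] at key
  linarith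

end HalfPlane

/-- The functions `gR` and `gL` continue `f` across the line from either side, so they supply the
traces; the values of `f` on the line itself play no role. -/
theorem IsJumpPoint.of_sides {F : Type*} [NormedAddCommGroup F] {Ω : Set Plane} {f gR gL : Plane → F}
    {x : Plane} (hx : x ∈ Ω) (hR : ContinuousAt gR x) (hL : ContinuousAt gL x)
    (hfR : ∀ᶠ z in 𝓝 x, x 0 < z 0 → f z = gR z) (hfL : ∀ᶠ z in 𝓝 x, z 0 < x 0 → f z = gL z)
    (hne : gR x ≠ gL x) : IsJumpPoint Ω f x (gR x) (gL x) e₁ := by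
  refine IsJumpPoint.of_tendsto hx norm_e₁ hne ?_ ?_
  · refine (hR.tendsto.mono_left nhdsWithin_le_nhds).congr' ?_
    filter_upwards [self_mem_nhdsWithin, nhdsWithin_le_nhds hfR] with z hz hz'
    rw [inner_e₁_right, PiLp.sub_apply, sub_pos] at hz
    exact (hz' hz).symm
  · refine (hL.tendsto.mono_left nhdsWithin_le_nhds).congr' ?_
    filter_upwards [self_mem_nhdsWithin, nhdsWithin_le_nhds hfL] with z hz hz'
    rw [inner_e₁_right, PiLp.sub_apply, sub_neg] at hz
    exact (hz' hz).symm

/-! ### Piecewise `C¹` functions with jumps on two vertical lines -/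

section Piecewise

/-- The density, with respect to Lebesgue measure plus the length measures on the lines `z₁ = p` and
`z₁ = q`, of the derivative of `g + w₁ χ_{z₁ > p} + w₂ χ_{z₁ > q}`. -/
noncomputable def piecewiseDensity (p q : ℝ) (g w₁ w₂ : Plane → ℝ) (z : Plane) : Plane :=
  if z 0 = q then w₂ z • e₁ else if z 0 = p then w₁ z • e₁ else
    gradient g z + indicator {z : Plane | p < z 0} (gradient w₁) z +
      indicator {z : Plane | q < z 0} (gradient w₂) z

variable {p q : ℝ} {g w₁ w₂ : Plane → ℝ}

theorem inner_gradient (g : Plane → ℝ) (z e : Plane) :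
    inner ℝ (gradient g z) e = fderiv ℝ g z e := by
  simp [gradient]

theorem continuous_gradient_of_contDiff (hg : ContDiff ℝ 1 g) : Continuous (gradient g) :=
  (LinearIsometryEquiv.continuous _).comp (hg.continuous_fderiv one_ne_zero)

theorem measurable_piecewiseDensity (hg : ContDiff ℝ 1 g) (h₁ : ContDiff ℝ 1 w₁)
    (h₂ : ContDiff ℝ 1 w₂) : Measurable (piecewiseDensity p q g w₁ w₂) := by
  have hm : ∀ c : ℝ, MeasurableSet {z : Plane | z 0 = c} := fun c =>
    (isClosed_eq (continuous_coord 0) continuous_const).measurableSet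
  refine Measurable.ite (hm q) (h₂.continuous.smul continuous_const).measurable
    (Measurable.ite (hm p) (h₁.continuous.smul continuous_const).measurable ?_)
  exact ((continuous_gradient_of_contDiff hg).measurable.add
    ((continuous_gradient_of_contDiff h₁).measurable.indicator
      (isOpen_halfPlane p).measurableSet)).add
    ((continuous_gradient_of_contDiff h₂).measurable.indicator (isOpen_halfPlane q).measurableSet)

theorem norm_piecewiseDensity_le (z : Plane) : ‖piecewiseDensity p q g w₁ w₂ z‖ ≤
    ‖w₂ z‖ + ‖w₁ z‖ + (‖gradient g z‖ + ‖gradient w₁ z‖ + ‖gradient w₂ z‖) := by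
  have n1 := norm_nonneg (w₁ z)
  have n2 := norm_nonneg (w₂ z)
  have n3 := norm_nonneg (gradient g z)
  have n4 := norm_nonneg (gradient w₁ z)
  have n5 := norm_nonneg (gradient w₂ z)
  rw [piecewiseDensity]
  split_ifs
  · rw [norm_smul, norm_e₁, mul_one]; linarith
  · rw [norm_smul, norm_e₁, mul_one]; linarith
  · have h1 := norm_indicator_le_norm_self (s := {z : Plane | p < z 0}) (gradient w₁) z
    have h2 := norm_indicator_le_norm_self (s := {z : Plane | q < z 0}) (gradient w₂) z
    have h3 := norm_add₃_le (a := gradient g z)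
      (b := indicator {z : Plane | p < z 0} (gradient w₁) z)
      (c := indicator {z : Plane | q < z 0} (gradient w₂) z)
    linarith

/-- Each of the three summands is integrated by parts on its own domain: the plane for `g`, a half
plane for `w₁` and `w₂`. The boundary terms are integrals against the two line measures. -/
theorem integral_mul_fderiv_piecewise (hpq : p < q) (hg : ContDiff ℝ 1 g) (h₁ : ContDiff ℝ 1 w₁)
    (h₂ : ContDiff ℝ 1 w₂) {φ : Plane → ℝ} (hφ : ContDiff ℝ 1 φ) (hc : HasCompactSupport φ)
    (e : Plane) :
    ∫ z, (g z + indicator {z : Plane | p < z 0} w₁ z + indicator {z : Plane | q < z 0} w₂ z) *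
      fderiv ℝ φ z e = - ∫ z, φ z * inner ℝ (piecewiseDensity p q g w₁ w₂ z) e
        ∂(volume + (verticalMeasure p + verticalMeasure q)) := by
  have hHp := (isOpen_halfPlane p).measurableSet
  have hHq := (isOpen_halfPlane q).measurableSet
  have hL : ∫ z, (g z + indicator {z : Plane | p < z 0} w₁ z +
      indicator {z : Plane | q < z 0} w₂ z) * fderiv ℝ φ z e =
      (∫ z, g z * fderiv ℝ φ z e) + (∫ z in {z : Plane | p < z 0}, w₁ z * fderiv ℝ φ z e) +
        ∫ z in {z : Plane | q < z 0}, w₂ z * fderiv ℝ φ z e := by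
    rw [← integral_indicator hHp, ← integral_indicator hHq, ← integral_add, ← integral_add]
    · refine integral_congr_ae (Eventually.of_forall fun z => ?_)
      simp only [indicator]
      split_ifs <;> ring
    · exact (integrable_mul_fderiv hg.continuous hφ hc e).add
        ((integrable_mul_fderiv h₁.continuous hφ hc e).indicator hHp)
    · exact (integrable_mul_fderiv h₂.continuous hφ hc e).indicator hHq
    · exact integrable_mul_fderiv hg.continuous hφ hc e
    · exact (integrable_mul_fderiv h₁.continuous hφ hc e).indicator hHp
  have hae : (fun z => φ z * inner ℝ (piecewiseDensity p q g w₁ w₂ z) e) =ᵐ[volume]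
      fun z => φ z * fderiv ℝ g z e +
        indicator {z : Plane | p < z 0} (fun z => φ z * fderiv ℝ w₁ z e) z +
        indicator {z : Plane | q < z 0} (fun z => φ z * fderiv ℝ w₂ z e) z := by
    filter_upwards [ae_coord_ne p, ae_coord_ne q] with z hzp hzq
    rw [piecewiseDensity, if_neg hzq, if_neg hzp, inner_add_left, inner_add_left, inner_gradient]
    simp only [indicator]
    split_ifs <;> simp only [inner_gradient, inner_zero_left] <;> ring
  have ig := integrable_mul_fderiv' hg hφ.continuous hc e
  have i1 := (integrable_mul_fderiv' h₁ hφ.continuous hc e).indicator hHp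
  have i2 := (integrable_mul_fderiv' h₂ hφ.continuous hc e).indicator hHq
  have hvol : ∫ z, φ z * inner ℝ (piecewiseDensity p q g w₁ w₂ z) e =
      (∫ z, φ z * fderiv ℝ g z e) + (∫ z in {z : Plane | p < z 0}, φ z * fderiv ℝ w₁ z e) +
        ∫ z in {z : Plane | q < z 0}, φ z * fderiv ℝ w₂ z e := by
    rw [integral_congr_ae hae, ← integral_indicator hHp, ← integral_indicator hHq,
      ← integral_add ig i1]
    exact integral_add (ig.add i1) i2
  have hp : (fun z => φ z * inner ℝ (piecewiseDensity p q g w₁ w₂ z) e) =ᵐ[verticalMeasure p]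
      fun z => e 0 * (w₁ z * φ z) := by
    filter_upwards [ae_verticalMeasure p] with z hz
    rw [piecewiseDensity, if_neg (by rw [hz]; exact hpq.ne), if_pos hz, real_inner_smul_left,
      real_inner_comm, inner_e₁_right]
    ring
  have hq : (fun z => φ z * inner ℝ (piecewiseDensity p q g w₁ w₂ z) e) =ᵐ[verticalMeasure q]
      fun z => e 0 * (w₂ z * φ z) := by
    filter_upwards [ae_verticalMeasure q] with z hz
    rw [piecewiseDensity, if_pos hz, real_inner_smul_left, real_inner_comm, inner_e₁_right]
    ring
  have ip : Integrable (fun z => e 0 * (w₁ z * φ z)) (verticalMeasure p) :=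
    ((h₁.continuous.mul hφ.continuous).integrable_of_hasCompactSupport hc.mul_left).const_mul _
  have iq : Integrable (fun z => e 0 * (w₂ z * φ z)) (verticalMeasure q) :=
    ((h₂.continuous.mul hφ.continuous).integrable_of_hasCompactSupport hc.mul_left).const_mul _
  have hIBP : ∫ z, g z * fderiv ℝ φ z e = - ∫ z, φ z * fderiv ℝ g z e := by
    rw [integral_mul_fderiv_eq_neg_fderiv_mul_of_integrable]
    · simp only [mul_comm]
    · simpa only [mul_comm] using ig
    · exact integrable_mul_fderiv hg.continuous hφ hc e
    · exact (hg.continuous.mul hφ.continuous).integrable_of_hasCompactSupport hc.mul_left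
    · exact fun z _ => hg.differentiable one_ne_zero z
    · exact fun z _ => hφ.differentiable one_ne_zero z
  rw [integral_add_measure (((ig.add i1).add i2).congr hae.symm)
      ((ip.congr hp.symm).add_measure (iq.congr hq.symm)),
    integral_add_measure (ip.congr hp.symm) (iq.congr hq.symm), hvol, integral_congr_ae hp,
    integral_congr_ae hq, hL, hIBP, setIntegral_halfPlane_mul_fderiv h₁ hφ hc,
    setIntegral_halfPlane_mul_fderiv h₂ hφ hc, integral_const_mul, integral_const_mul,
    integral_verticalMeasure, integral_verticalMeasure]
  ring

theorem eventually_coord_lt {x : Plane} {c : ℝ} (h : x 0 < c) : ∀ᶠ z in 𝓝 x, z 0 < c :=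
  (continuous_coord 0).continuousAt.eventually_lt_const h

theorem eventually_lt_coord {x : Plane} {c : ℝ} (h : c < x 0) : ∀ᶠ z in 𝓝 x, c < z 0 :=
  (continuous_coord 0).continuousAt.eventually_const_lt h

theorem isSBVLoc_add_indicator {U : Set Plane} (hU : IsOpen U) (hpq : p < q)
    (hg : ContDiff ℝ 1 g) (h₁ : ContDiff ℝ 1 w₁) (h₂ : ContDiff ℝ 1 w₂) {v : Plane → ℝ}
    (hv : ∀ z : Plane, z 0 ≠ p → z 0 ≠ q → v z = g z + indicator {z : Plane | p < z 0} w₁ z +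
      indicator {z : Plane | q < z 0} w₂ z) : IsSBVLoc U v := by
  have hHp := (isOpen_halfPlane p).measurableSet
  have hHq := (isOpen_halfPlane q).measurableSet
  have hvae : v =ᵐ[volume] fun z => g z + indicator {z : Plane | p < z 0} w₁ z +
      indicator {z : Plane | q < z 0} w₂ z := by
    filter_upwards [ae_coord_ne p, ae_coord_ne q] with z hzp hzq using hv z hzp hzq
  refine ⟨_, _, hasSBVDeriv_of_density (G := piecewiseDensity p q g w₁ w₂)
    (m := volume + (verticalMeasure p + verticalMeasure q)) hU
    (measurable_piecewiseDensity hg h₁ h₂) ?_ ?_ ?_ ?_ ?_⟩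
  · intro K hK
    simp only [Measure.add_apply]
    exact ENNReal.add_lt_top.2 ⟨hK.measure_lt_top, ENNReal.add_lt_top.2
      ⟨verticalMeasure_lt_top p hK, verticalMeasure_lt_top q hK⟩⟩
  · intro K hK
    have hcont : Continuous fun z => ‖w₂ z‖ + ‖w₁ z‖ +
        (‖gradient g z‖ + ‖gradient w₁ z‖ + ‖gradient w₂ z‖) := by
      have := h₁.continuous
      have := h₂.continuous
      have := continuous_gradient_of_contDiff hg
      have := continuous_gradient_of_contDiff h₁
      have := continuous_gradient_of_contDiff h₂
      fun_prop
    obtain ⟨c, hc⟩ := hK.bddAbove_image hcont.continuousOn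
    exact ⟨c, fun x hx => (norm_piecewiseDensity_le x).trans (hc (mem_image_of_mem _ hx))⟩
  · refine LocallyIntegrable.locallyIntegrableOn ?_ U
    rw [locallyIntegrable_congr hvae]
    exact (hg.continuous.locallyIntegrable.add
      (h₁.continuous.locallyIntegrable.indicator hHp)).add
        (h₂.continuous.locallyIntegrable.indicator hHq)
  · intro φ hφ hc hsupp e
    have hφ1 : ContDiff ℝ 1 φ := hφ.of_le (by exact_mod_cast le_top)
    have hzero : ∀ z, z ∉ U → φ z = 0 := fun z hz => image_eq_zero_of_notMem_tsupport
      fun h => hz (hsupp h)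
    have hzero' : ∀ z, z ∉ U → fderiv ℝ φ z e = 0 := fun z hz => by
      rw [image_eq_zero_of_notMem_tsupport fun h => hz (hsupp (tsupport_fderiv_subset ℝ h))]
      rfl
    rw [setIntegral_eq_integral_of_forall_compl_eq_zero fun z hz => by rw [hzero' z hz, mul_zero],
      setIntegral_eq_integral_of_forall_compl_eq_zero fun z hz => by rw [hzero z hz, zero_mul],
      ← integral_mul_fderiv_piecewise hpq hg h₁ h₂ hφ1 hc e]
    refine integral_congr_ae ?_
    filter_upwards [hvae] with z hz
    rw [hz]
  · intro A hA hA0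
    rw [ae_add_measure_iff, ae_add_measure_iff]
    refine ⟨?_, ?_, ?_⟩
    · have : ∀ᵐ z : Plane, z ∉ A := by simpa [ae_iff] using hA0
      filter_upwards [this] with z hz _ using hz
    -- On a line the density is a multiple of the jump height. Where it is nonzero the two traces
    -- differ, so the point belongs to the jump set, which `A` avoids.
    · filter_upwards [ae_verticalMeasure p] with z hz hne hzA
      have hzq : z 0 ≠ q := by rw [hz]; exact hpq.ne
      rw [piecewiseDensity, if_neg hzq, if_pos hz] at hne
      have hw : w₁ z ≠ 0 := fun h => hne (by rw [h, zero_smul])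
      have hzq' : z 0 < q := by rw [hz]; exact hpq
      refine (hA hzA).2 ⟨_, _, _, IsJumpPoint.of_sides (gR := fun z => g z + w₁ z) (gL := g)
        (hA hzA).1 (hg.continuous.add h₁.continuous).continuousAt hg.continuous.continuousAt
        ?_ ?_ (by simpa using hw)⟩
      · filter_upwards [eventually_coord_lt hzq'] with y hy hlt
        rw [hz] at hlt
        rw [hv y hlt.ne' hy.ne, indicator_of_mem (by exact hlt),
          indicator_of_notMem (by exact hy.not_gt), add_zero]
      · filter_upwards [eventually_coord_lt hzq'] with y hy hlt
        rw [hz] at hlt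
        rw [hv y hlt.ne hy.ne, indicator_of_notMem (by exact hlt.not_gt),
          indicator_of_notMem (by exact hy.not_gt), add_zero, add_zero]
    · filter_upwards [ae_verticalMeasure q] with z hz hne hzA
      rw [piecewiseDensity, if_pos hz] at hne
      have hw : w₂ z ≠ 0 := fun h => hne (by rw [h, zero_smul])
      have hzp : p < z 0 := by rw [hz]; exact hpq
      refine (hA hzA).2 ⟨_, _, _, IsJumpPoint.of_sides (gR := fun z => g z + w₁ z + w₂ z)
        (gL := fun z => g z + w₁ z) (hA hzA).1
        ((hg.continuous.add h₁.continuous).add h₂.continuous).continuousAt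
        (hg.continuous.add h₁.continuous).continuousAt ?_ ?_ (by simpa using hw)⟩
      · filter_upwards [eventually_lt_coord hzp] with y hy hlt
        rw [hz] at hlt
        rw [hv y hy.ne' hlt.ne', indicator_of_mem (by exact hy), indicator_of_mem (by exact hlt)]
      · filter_upwards [eventually_lt_coord hzp] with y hy hlt
        rw [hz] at hlt
        rw [hv y hy.ne' hlt.ne, indicator_of_mem (by exact hy),
          indicator_of_notMem (by exact hlt.not_gt), add_zero]

/-- A function that is `C¹` up to the boundary on both sides of, and between, two vertical lines is
in `SBV_loc`. -/
theorem isSBVLoc_piecewise {U : Set Plane} (hU : IsOpen U) (hpq : p < q) {g₁ g₂ g₃ : Plane → ℝ}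
    (h₁ : ContDiff ℝ 1 g₁) (h₂ : ContDiff ℝ 1 g₂) (h₃ : ContDiff ℝ 1 g₃) {v : Plane → ℝ}
    (hv₁ : ∀ z : Plane, z 0 < p → v z = g₁ z) (hv₂ : ∀ z : Plane, p < z 0 → z 0 < q → v z = g₂ z)
    (hv₃ : ∀ z : Plane, q < z 0 → v z = g₃ z) : IsSBVLoc U v := by
  -- Telescoping: the coefficient of each indicator is the difference of the two neighbouring
  -- functions.
  refine isSBVLoc_add_indicator hU hpq h₁ (h₂.sub h₁) (h₃.sub h₂) fun z hzp hzq => ?_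
  rcases lt_or_gt_of_ne hzp with h | h
  · rw [hv₁ z h, indicator_of_notMem (by exact h.not_gt),
      indicator_of_notMem (by exact (h.trans hpq).not_gt), add_zero, add_zero]
  rcases lt_or_gt_of_ne hzq with h' | h'
  · rw [hv₂ z h h', indicator_of_mem (by exact h), indicator_of_notMem (by exact h'.not_gt)]
    ring
  · rw [hv₃ z h', indicator_of_mem (by exact h), indicator_of_mem (by exact h')]
    ring

end Piecewise

/-! ### The square -/

section Square

theorem isOpen_openSquare : IsOpen openSquare := by
  have : openSquare = ⋂ i : Fin 2, {x : Plane | x i ∈ Ioo (-1 : ℝ) 1} := by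
    ext x; simp [openSquare]
  rw [this]
  exact isOpen_iInter_of_finite fun i => isOpen_Ioo.preimage (continuous_coord i)

theorem volume_strip_le (a b : ℝ) :
    volume {z : Plane | z ∈ openSquare ∧ z 0 ∈ Ioo a b} ≤ ENNReal.ofReal (b - a) * 2 := by
  rw [← measurePreserving_plane_mk.measure_preimage_emb measurableEmbedding_plane_mk]
  calc volume ((fun p : ℝ × ℝ => (!₂[p.1, p.2] : Plane)) ⁻¹'
        {z : Plane | z ∈ openSquare ∧ z 0 ∈ Ioo a b}) ≤ volume (Ioo a b ×ˢ Ioo (-1 : ℝ) 1) := by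
        refine measure_mono ?_
        rintro ⟨s, t⟩ ⟨h1, h2⟩
        exact ⟨h2, h1 1⟩
    _ = ENNReal.ofReal (b - a) * 2 := by
        rw [Measure.volume_eq_prod, Measure.prod_prod, Real.volume_Ioo, Real.volume_Ioo]
        norm_num

theorem volume_openSquare_lt_top : volume openSquare < ⊤ := by
  have h : openSquare = {z : Plane | z ∈ openSquare ∧ z 0 ∈ Ioo (-1 : ℝ) 1} := by
    ext z
    exact ⟨fun hz => ⟨hz, hz 0⟩, fun hz => hz.1⟩
  rw [h]
  exact (volume_strip_le _ _).trans_lt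
    (ENNReal.mul_lt_top ENNReal.ofReal_lt_top (by simp))

instance : IsFiniteMeasure ((volume : Measure Plane).restrict openSquare) :=
  ⟨by simpa using volume_openSquare_lt_top⟩

/-- The vertical chord of the square at abscissa `c`. -/
def squareChord (c : ℝ) : Set Plane := {x | x ∈ openSquare ∧ x 0 = c}

theorem squareChord_eq_image {c : ℝ} (hc : c ∈ Ioo (-1 : ℝ) 1) :
    squareChord c = (fun t : ℝ => (!₂[c, t] : Plane)) '' Ioo (-1 : ℝ) 1 := by
  ext z
  constructor
  · rintro ⟨hz, hzc⟩
    refine ⟨z 1, hz 1, ?_⟩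
    ext i; fin_cases i <;> simp [hzc]
  · rintro ⟨t, ht, rfl⟩
    refine ⟨fun i => ?_, by simp⟩
    fin_cases i
    · simpa using hc
    · simpa using ht

theorem hausdorffMeasure_squareChord {c : ℝ} (hc : c ∈ Ioo (-1 : ℝ) 1) :
    Measure.hausdorffMeasure 1 (squareChord c) = 2 := by
  rw [squareChord_eq_image hc, (isometry_vertical c).hausdorffMeasure_image (Or.inl zero_le_one),
    hausdorffMeasure_real, Real.volume_Ioo]
  norm_num

theorem squareChord_eq_empty {c : ℝ} (hc : c ∉ Ioo (-1 : ℝ) 1) : squareChord c = ∅ := by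
  ext z
  simp only [squareChord, mem_ofPred_eq, mem_empty_iff_false, iff_false]
  rintro ⟨hz, rfl⟩
  exact hc (hz 0)

theorem hausdorffMeasure_squareChord_le (c : ℝ) :
    Measure.hausdorffMeasure 1 (squareChord c) ≤ 2 := by
  by_cases hc : c ∈ Ioo (-1 : ℝ) 1
  · exact (hausdorffMeasure_squareChord hc).le
  · rw [squareChord_eq_empty hc]; simp

theorem measurableSet_squareChord (c : ℝ) : MeasurableSet (squareChord c) :=
  isOpen_openSquare.measurableSet.inter
    (isClosed_eq (continuous_coord 0) continuous_const).measurableSet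

end Square

/-! ### Step functions on the line -/

section Step

/-- The step function obtained by slicing `(-1,0) χ_{x₁ > 0}`. -/
noncomputable def stepFun (α β : ℝ) (t : ℝ) : ℝ := if 0 < α + t * β then -β else 0

variable {α β : ℝ}

theorem stepFun_of_pos (hβ : 0 < β) : stepFun α β = indicator (Ioi (-α / β)) fun _ => -β := by
  ext t
  have : 0 < α + t * β ↔ t ∈ Ioi (-α / β) := by
    rw [mem_Ioi, div_lt_iff₀ hβ]
    constructor <;> intro h <;> linarith
  simp only [stepFun, indicator, this]

theorem stepFun_of_neg (hβ : β < 0) : stepFun α β = indicator (Iio (-α / β)) fun _ => -β := by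
  ext t
  have : 0 < α + t * β ↔ t ∈ Iio (-α / β) := by
    rw [mem_Iio, lt_div_iff_of_neg hβ]
    constructor <;> intro h <;> linarith
  simp only [stepFun, indicator, this]

theorem stepFun_of_eq_zero (α : ℝ) : stepFun α 0 = 0 := by
  ext t
  simp [stepFun]

theorem measurable_stepFun : Measurable (stepFun α β) :=
  Measurable.ite (measurableSet_lt measurable_const (by fun_prop)) measurable_const measurable_const

theorem norm_stepFun_le (t : ℝ) : ‖stepFun α β t‖ ≤ ‖β‖ := by
  rw [stepFun]
  split_ifs <;> simp

theorem continuousAt_stepFun {t : ℝ} (ht : β ≠ 0 → t ≠ -α / β) : ContinuousAt (stepFun α β) t := by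
  rcases lt_trichotomy β 0 with hβ | rfl | hβ
  · rw [stepFun_of_neg hβ]
    rcases lt_or_gt_of_ne (ht hβ.ne) with h | h
    · exact continuousAt_const.congr ((eqOn_indicator.eventuallyEq_of_mem (Iio_mem_nhds h)).symm)
    · refine (continuousAt_const : ContinuousAt (fun _ : ℝ => (0 : ℝ)) t).congr ?_
      filter_upwards [Ioi_mem_nhds h] with s hs
      rw [indicator_of_notMem (by simpa using (mem_Ioi.1 hs).le)]
  · rw [stepFun_of_eq_zero]
    exact continuousAt_const
  · rw [stepFun_of_pos hβ]
    rcases lt_or_gt_of_ne (ht hβ.ne') with h | h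
    · refine (continuousAt_const : ContinuousAt (fun _ : ℝ => (0 : ℝ)) t).congr ?_
      filter_upwards [Iio_mem_nhds h] with s hs
      rw [indicator_of_notMem (by simpa using (mem_Iio.1 hs).le)]
    · exact continuousAt_const.congr ((eqOn_indicator.eventuallyEq_of_mem (Ioi_mem_nhds h)).symm)

theorem jumpSet_stepFun_subset {U : Set ℝ} (hU : IsOpen U) {t : ℝ}
    (ht : t ∈ jumpSet U (stepFun α β)) : β ≠ 0 ∧ t = -α / β := by
  by_contra h
  refine notMem_jumpSet_of_continuousAt hU (continuousAt_stepFun fun hβ => ?_) ht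
  exact fun h' => h ⟨hβ, h'⟩

theorem mem_jumpSet_stepFun {U : Set ℝ} (hβ : β ≠ 0) (ht : -α / β ∈ U) :
    -α / β ∈ jumpSet U (stepFun α β) := by
  have hpos : {z : ℝ | 0 < inner ℝ (z - -α / β) (1 : ℝ)} = Ioi (-α / β) := by
    ext z; simp
  have hneg : {z : ℝ | inner ℝ (z - -α / β) (1 : ℝ) < 0} = Iio (-α / β) := by
    ext z; simp
  rcases lt_or_gt_of_ne hβ with h | h
  · refine ⟨0, -β, 1, IsJumpPoint.of_tendsto ht (by simp) (by simpa using hβ) ?_ ?_⟩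
    · rw [hpos, stepFun_of_neg h]
      refine tendsto_const_nhds.congr' ?_
      filter_upwards [self_mem_nhdsWithin] with s hs
      rw [indicator_of_notMem (by simpa using (mem_Ioi.1 hs).le)]
    · rw [hneg, stepFun_of_neg h]
      refine tendsto_const_nhds.congr' ?_
      filter_upwards [self_mem_nhdsWithin] with s hs
      rw [indicator_of_mem hs]
  · refine ⟨-β, 0, 1, IsJumpPoint.of_tendsto ht (by simp) (by simpa using hβ) ?_ ?_⟩
    · rw [hpos, stepFun_of_pos h]
      refine tendsto_const_nhds.congr' ?_
      filter_upwards [self_mem_nhdsWithin] with s hs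
      rw [indicator_of_mem hs]
    · rw [hneg, stepFun_of_pos h]
      refine tendsto_const_nhds.congr' ?_
      filter_upwards [self_mem_nhdsWithin] with s hs
      rw [indicator_of_notMem (by simpa using (mem_Iio.1 hs).le)]

theorem integral_stepFun_mul_deriv {φ : ℝ → ℝ} (hφ : ContDiff ℝ 1 φ) (hc : HasCompactSupport φ) :
    ∫ t, stepFun α β t * deriv φ t = |β| * φ (-α / β) := by
  rcases lt_trichotomy β 0 with hβ | rfl | hβ
  · have : (fun t => stepFun α β t * deriv φ t) =
        indicator (Iio (-α / β)) fun t => -β * deriv φ t := by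
      rw [stepFun_of_neg hβ]
      ext t
      simp only [indicator]
      split_ifs <;> simp
    rw [this, integral_indicator measurableSet_Iio, integral_const_mul,
      ← integral_Iic_eq_integral_Iio, hc.integral_Iic_deriv_eq hφ, abs_of_neg hβ]
  · simp [stepFun_of_eq_zero]
  · have : (fun t => stepFun α β t * deriv φ t) =
        indicator (Ioi (-α / β)) fun t => -β * deriv φ t := by
      rw [stepFun_of_pos hβ]
      ext t
      simp only [indicator]
      split_ifs <;> simp
    rw [this, integral_indicator measurableSet_Ioi, integral_const_mul,
      hc.integral_Ioi_deriv_eq hφ, abs_of_pos hβ]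
    ring

/-- For either sign of `β` the function drops by `|β|` at `-α / β` as `t` increases, so its
derivative is `-|β|` times a Dirac mass. For `β = 0` the location is a meaningless default, but the
weight vanishes. -/
theorem hasSBVDeriv_stepFun {U : Set ℝ} (hU : IsOpen U) (α β : ℝ) :
    ∃ σ : ℝ → ℝ, HasSBVDeriv U (stepFun α β) σ
      ((Measure.dirac (-α / β)).withDensity fun _ => ‖-|β|‖ₑ) := by
  refine ⟨_, hasSBVDeriv_of_density (G := fun _ => -|β|) hU measurable_const
    (fun K _ => measure_lt_top _ _) (fun K _ => ⟨_, fun x _ => le_rfl⟩) ?_ ?_ ?_⟩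
  · refine LocallyIntegrable.locallyIntegrableOn ?_ U
    exact (locallyIntegrable_const (‖β‖)).mono measurable_stepFun.aestronglyMeasurable
      (Eventually.of_forall fun t => by simpa using norm_stepFun_le t)
  · intro φ hφ hc hsupp e
    have hφ1 : ContDiff ℝ 1 φ := hφ.of_le (by exact_mod_cast le_top)
    have hzero : ∀ z, z ∉ U → φ z = 0 := fun z hz => image_eq_zero_of_notMem_tsupport
      fun h => hz (hsupp h)
    have hzero' : ∀ z, z ∉ U → fderiv ℝ φ z e = 0 := fun z hz => by
      rw [image_eq_zero_of_notMem_tsupport fun h => hz (hsupp (tsupport_fderiv_subset ℝ h))]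
      rfl
    rw [setIntegral_eq_integral_of_forall_compl_eq_zero fun z hz => by rw [hzero' z hz, mul_zero],
      setIntegral_eq_integral_of_forall_compl_eq_zero fun z hz => by rw [hzero z hz, zero_mul],
      integral_dirac]
    have : ∀ t, stepFun α β t * fderiv ℝ φ t e = e * (stepFun α β t * deriv φ t) := by
      intro t
      rw [fderiv_eq_smul_deriv, smul_eq_mul]
      ring
    simp only [this]
    rw [integral_const_mul, integral_stepFun_mul_deriv hφ1 hc]
    simp
    ring
  · intro A hA _
    rw [ae_dirac_eq]
    intro hne hmem
    exact (hA hmem).2 (mem_jumpSet_stepFun (by simpa using hne) (hA hmem).1)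

end Step

/-! ### The limit displacement -/

section Limit

theorem limitDisp_of_pos {z : Plane} (hz : 0 < z 0) : limitDisp z = -e₁ := by
  rw [limitDisp, indicator_of_mem (by exact hz)]
  ext i; fin_cases i <;> simp [e₁]

theorem limitDisp_of_nonpos {z : Plane} (hz : z 0 ≤ 0) : limitDisp z = 0 := by
  rw [limitDisp, indicator_of_notMem (by exact hz.not_gt)]

theorem limitDisp_eventuallyEq {x : Plane} (hx : x 0 ≠ 0) :
    ∃ c, ∀ᶠ z in 𝓝 x, limitDisp z = c := by
  rcases lt_or_gt_of_ne hx with h | h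
  · exact ⟨0, by filter_upwards [eventually_coord_lt h] with z hz using limitDisp_of_nonpos hz.le⟩
  · exact ⟨-e₁, by filter_upwards [eventually_lt_coord h] with z hz using limitDisp_of_pos hz⟩

theorem e₁_ne_zero : e₁ ≠ 0 := norm_ne_zero_iff.1 (by rw [norm_e₁]; exact one_ne_zero)

theorem isJumpPoint_limitDisp {x : Plane} (hx : x ∈ openSquare) (hx0 : x 0 = 0) :
    IsJumpPoint openSquare limitDisp x (-e₁) 0 e₁ := by
  refine IsJumpPoint.of_sides (gR := fun _ => -e₁) (gL := fun _ => 0) hx continuousAt_const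
    continuousAt_const (Eventually.of_forall fun z hz => ?_)
    (Eventually.of_forall fun z hz => ?_) (neg_ne_zero.2 e₁_ne_zero)
  · exact limitDisp_of_pos (hx0 ▸ hz)
  · exact limitDisp_of_nonpos (hx0 ▸ hz.le)

theorem jumpSet_limitDisp : jumpSet openSquare limitDisp = squareChord 0 := by
  ext x
  refine ⟨fun hx => ?_, fun hx => ⟨_, _, _, isJumpPoint_limitDisp hx.1 hx.2⟩⟩
  have hxΩ : x ∈ openSquare := by
    obtain ⟨a, b, ν, h⟩ := hx
    exact h.mem
  refine ⟨hxΩ, ?_⟩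
  by_contra hne
  obtain ⟨c, hc⟩ := limitDisp_eventuallyEq hne
  exact notMem_jumpSet_of_continuousAt isOpen_openSquare
    (continuousAt_const.congr (by filter_upwards [hc] with z hz using hz.symm)) hx

/-- The trace of a jump of `limitDisp` is the value taken on any open cone that meets both the
corresponding half plane and a half plane of constancy. -/
theorem limitDisp_trace_eq {x μ a y : Plane} {H : Set ℝ} {l : Plane} (hx : x ∈ openSquare)
    (hx0 : x 0 = 0) (hH : IsOpen H) (hHcone : ∀ r : ℝ, 0 < r → ∀ s ∈ H, r * s ∈ H)
    (hl : ∀ z : Plane, z 0 ∈ H → limitDisp z = l)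
    (ha : HasApLim (openSquare ∩ {z | 0 < inner ℝ (z - x) μ}) limitDisp x a)
    (hy : 0 < inner ℝ y μ) (hy0 : y 0 ∈ H) : a = l := by
  refine ha.eq_of_tendsto (C := {z | 0 < inner ℝ z μ} ∩ {z | z 0 ∈ H})
    ((isOpen_lt (by fun_prop) (by fun_prop)).inter (hH.preimage (continuous_coord 0)))
    ⟨y, hy, hy0⟩ ?_ ?_ ?_
  · rintro r hr z ⟨h1, h2⟩
    refine ⟨?_, by simpa using hHcone r hr _ h2⟩
    simp only [mem_ofPred_eq, real_inner_smul_left] at h1 ⊢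
    positivity
  · filter_upwards [isOpen_openSquare.mem_nhds hx] with z hz hzC using ⟨hz, hzC.1⟩
  · refine tendsto_const_nhds.congr' ?_
    filter_upwards [self_mem_nhdsWithin] with z hz
    have h2 : (z - x) 0 ∈ H := hz.2
    rw [PiLp.sub_apply, hx0, sub_zero] at h2
    exact (hl z h2).symm

/-- An inclined normal is impossible: its positive half plane would meet both sides of the line `z 0
= 0` in open cones, and the trace would be both `-e₁` and `0`. Hence `ν = ±e₁`, and changing the
sign of `ν` exchanges the traces. -/
theorem inner_normal_jump_limitDisp {x a b ν : Plane}
    (h : IsJumpPoint openSquare limitDisp x a b ν) : inner ℝ ν (a - b) = -1 := by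
  have hx : x ∈ squareChord 0 := by
    rw [← jumpSet_limitDisp]; exact ⟨a, b, ν, h⟩
  have hinner : ∀ z : Plane, inner ℝ z ν = z 0 * ν 0 + z 1 * ν 1 := fun z => by
    simp [PiLp.inner_apply, Fin.sum_univ_two, mul_comm]
  -- The trace on the negative side is the one on the positive side for `-ν`, so
  -- `limitDisp_trace_eq` serves both.
  have hneg : HasApLim (openSquare ∩ {z | 0 < inner ℝ (z - x) (-ν)}) limitDisp x b := by
    simpa using h.neg
  have hpcone : ∀ r : ℝ, 0 < r → ∀ s ∈ Ioi (0 : ℝ), r * s ∈ Ioi (0 : ℝ) :=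
    fun r hr s hs => mul_pos hr hs
  have hncone : ∀ r : ℝ, 0 < r → ∀ s ∈ Iio (0 : ℝ), r * s ∈ Iio (0 : ℝ) :=
    fun r hr s hs => mul_neg_of_pos_of_neg hr hs
  have hp : ∀ z : Plane, z 0 ∈ Ioi (0 : ℝ) → limitDisp z = -e₁ := fun z hz => limitDisp_of_pos hz
  have hn : ∀ z : Plane, z 0 ∈ Iio (0 : ℝ) → limitDisp z = 0 :=
    fun z hz => limitDisp_of_nonpos (mem_Iio.1 hz).le
  have hunit : ν 0 ^ 2 + ν 1 ^ 2 = 1 := by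
    have := EuclideanSpace.real_norm_sq_eq ν
    rw [h.norm_normal, Fin.sum_univ_two] at this
    linarith
  have hν1 : ν 1 = 0 := by
    by_contra hν1
    -- When `ν 1 ≠ 0`, a vector in the positive half plane may have any prescribed first coordinate
    -- `s`.
    have key : ∀ s : ℝ, inner ℝ (!₂[s, (1 - s * ν 0) / ν 1] : Plane) ν = 1 := fun s => by
      rw [hinner]
      simp
      field_simp
      ring
    have h1 := limitDisp_trace_eq (y := !₂[1, (1 - 1 * ν 0) / ν 1]) hx.1 hx.2 isOpen_Ioi hpcone hp
      h.pos (by rw [key]; exact one_pos) (by simp)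
    have h2 := limitDisp_trace_eq (y := !₂[-1, (1 - -1 * ν 0) / ν 1]) hx.1 hx.2 isOpen_Iio hncone
      hn h.pos (by rw [key]; exact one_pos) (by simp)
    exact neg_ne_zero.2 e₁_ne_zero (h1.symm.trans h2)
  have hinner' : ∀ z : Plane, inner ℝ z ν = z 0 * ν 0 := fun z => by rw [hinner, hν1]; ring
  have hν0 : ν 0 = 1 ∨ ν 0 = -1 := mul_self_eq_one_iff.1 (by rw [hν1] at hunit; linarith)
  have he : (e₁ : Plane) 0 = 1 := by simp [e₁]
  rcases hν0 with h0 | h0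
  · have ha := limitDisp_trace_eq (y := e₁) hx.1 hx.2 isOpen_Ioi hpcone hp h.pos
      (by rw [hinner', h0, he]; norm_num) (by rw [he]; exact mem_Ioi.2 one_pos)
    have hb := limitDisp_trace_eq (y := -e₁) hx.1 hx.2 isOpen_Iio hncone hn hneg
      (by rw [inner_neg_neg, hinner', h0, he]; norm_num) (by simp [he])
    rw [ha, hb, real_inner_comm, hinner', h0]
    simp [he]
  · have ha := limitDisp_trace_eq (y := -e₁) hx.1 hx.2 isOpen_Iio hncone hn h.pos
      (by rw [hinner', h0]; simp [he]) (by simp [he])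
    have hb := limitDisp_trace_eq (y := e₁) hx.1 hx.2 isOpen_Ioi hpcone hp hneg
      (by rw [inner_neg_right, hinner', h0, he]; norm_num) (by rw [he]; exact mem_Ioi.2 one_pos)
    rw [ha, hb, real_inner_comm, hinner', h0]
    simp [he]

theorem not_contactCondition_limitDisp : ¬ ContactCondition openSquare limitDisp := by
  intro h
  have h0 : ∀ᵐ x ∂(Measure.hausdorffMeasure 1 : Measure Plane), x ∉ squareChord 0 := by
    filter_upwards [h] with x hx hmem
    have := hx (by rwa [jumpSet_limitDisp]) _ _ _ (isJumpPoint_limitDisp hmem.1 hmem.2)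
    rw [inner_normal_jump_limitDisp (isJumpPoint_limitDisp hmem.1 hmem.2)] at this
    linarith
  have h1 : Measure.hausdorffMeasure 1 (squareChord 0) = 0 := by simpa [ae_iff] using h0
  rw [hausdorffMeasure_squareChord (by simp)] at h1
  exact two_ne_zero h1

theorem sliceFun_limitDisp (ξ w : Plane) : sliceFun limitDisp ξ w = stepFun (w 0) (ξ 0) := by
  ext t
  have hc : (w + t • ξ) 0 = w 0 + t * ξ 0 := by simp
  rw [sliceFun, stepFun]
  split_ifs with h
  · rw [limitDisp_of_pos (by rwa [hc]), inner_neg_left, real_inner_comm, inner_e₁_right]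
  · rw [limitDisp_of_nonpos (by rw [hc]; exact not_lt.1 h), inner_zero_left]

/-- This map is the orthogonal projection onto `orthLine ξ`; the bound lets it not increase length
in the GSBD estimate. -/
theorem lipschitzWith_sub_inner_smul {ξ : Plane} (hξ : ‖ξ‖ = 1) :
    LipschitzWith 1 fun z : Plane => z - (inner ℝ z ξ : ℝ) • ξ := by
  refine LipschitzWith.of_dist_le_mul fun y z => ?_
  have h1 : y - (inner ℝ y ξ : ℝ) • ξ - (z - (inner ℝ z ξ : ℝ) • ξ) =
      (y - z) - (inner ℝ (y - z) ξ : ℝ) • ξ := by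
    rw [inner_sub_left, sub_smul]
    abel
  rw [dist_eq_norm, dist_eq_norm, h1, NNReal.coe_one, one_mul]
  refine le_of_sq_le_sq ?_ (norm_nonneg _)
  rw [norm_sub_sq_real, norm_smul, real_inner_smul_right, hξ, Real.norm_eq_abs, mul_one, sq_abs]
  nlinarith [sq_nonneg (inner ℝ (y - z) ξ : ℝ)]

theorem isOpen_sliceSet {B : Set Plane} (hB : IsOpen B) (ξ w : Plane) : IsOpen (sliceSet B ξ w) :=
  hB.preimage (by fun_prop : Continuous fun t : ℝ => w + t • ξ)

theorem measurableSet_sliceSet {B : Set Plane} (hB : MeasurableSet B) (ξ w : Plane) :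
    MeasurableSet (sliceSet B ξ w) :=
  (by fun_prop : Continuous fun t : ℝ => w + t • ξ).measurable hB

/-- The contribution of a single slice to the `GSBD` bound. -/
theorem slice_variation_le {α β : ℝ} (hβ : |β| ≤ 1) {U S : Set ℝ} (hU : IsOpen U)
    (hS : MeasurableSet S) (P : Prop) (hP : β ≠ 0 → -α / β ∈ S → P) [Decidable P] :
    ((Measure.dirac (-α / β)).withDensity fun _ => ‖-|β|‖ₑ)
        (S \ largeJumpSet U (stepFun α β)) +
      ((S ∩ largeJumpSet U (stepFun α β)).encard : ℝ≥0∞) ≤ if P then 1 else 0 := by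
  set J := largeJumpSet U (stepFun α β) with hJ
  have hJsub : ∀ t ∈ J, β ≠ 0 ∧ t = -α / β := by
    rintro t ⟨a, b, ν, h, _⟩
    exact jumpSet_stepFun_subset hU ⟨a, b, ν, h⟩
  rw [withDensity_const, Measure.smul_apply, smul_eq_mul]
  by_cases hβ0 : β = 0
  · have hJe : J = ∅ := eq_empty_of_forall_notMem fun t ht => (hJsub t ht).1 hβ0
    rw [hJe]
    simp [hβ0]
  by_cases hmem : -α / β ∈ S
  · rw [if_pos (hP hβ0 hmem)]
    -- The jump has height `|β| ≤ 1`. If it counts as large it contributes 1 to the counting term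
    -- and nothing to the variation; otherwise it contributes `|β|` to the variation only.
    by_cases hmJ : -α / β ∈ J
    · have hJe : J = {-α / β} :=
        Subset.antisymm (fun t ht => (hJsub t ht).2) (singleton_subset_iff.2 hmJ)
      rw [hJe, inter_eq_self_of_subset_right (singleton_subset_iff.2 hmem), encard_singleton,
        Measure.dirac_apply' _ (hS.diff (measurableSet_singleton _))]
      simp
    · have hJe : J = ∅ := eq_empty_of_forall_notMem fun t ht => hmJ ((hJsub t ht).2 ▸ ht)
      rw [hJe, sdiff_empty, inter_empty, encard_empty, Measure.dirac_apply_of_mem hmem, mul_one,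
        ← ofReal_norm]
      simpa using hβ
  · have h0 : (Measure.dirac (-α / β)) (S \ J) = 0 :=
      measure_mono_null sdiff_subset (by rw [Measure.dirac_apply' _ hS]; simp [hmem])
    have h1 : S ∩ J = ∅ :=
      eq_empty_of_forall_notMem fun t ht => hmem ((hJsub t ht.2).2 ▸ ht.1)
    rw [h0, h1]
    simp

/-- A slice jumps at most once, where its line crosses the chord, and contributes at most 1.
Integrating over the slices through `B` therefore gives at most the length of the projection of `B ∩
squareChord 0`, hence at most the length of this set. So `Λ` can be the length measure on the chord,
for all directions at once. -/
theorem isGSBD_limitDisp : IsGSBD openSquare limitDisp := by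
  classical
  refine ⟨(measurable_const.indicator
    (isOpen_halfPlane 0).measurableSet).aestronglyMeasurable,
    (Measure.hausdorffMeasure 1).restrict (squareChord 0), ⟨?_⟩, fun ξ hξ => ?_⟩
  · rw [Measure.restrict_apply_univ, hausdorffMeasure_squareChord (by simp)]
    simp
  refine ⟨fun w => (Measure.dirac (-w 0 / ξ 0)).withDensity fun _ => ‖-|ξ 0|‖ₑ,
    Eventually.of_forall fun w => ?_, fun B hB hBΩ => ?_⟩
  · rw [sliceFun_limitDisp]
    exact hasSBVDeriv_stepFun (isOpen_sliceSet isOpen_openSquare ξ w) _ _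
  have hξ0 : |ξ 0| ≤ 1 := by
    rw [← hξ]
    exact PiLp.norm_apply_le ξ 0
  have hmeas : MeasurableSet (orthLine ξ) :=
    (isClosed_eq (by fun_prop : Continuous fun w : Plane => (inner ℝ w ξ : ℝ))
      continuous_const).measurableSet
  set S := (fun z : Plane => z - (inner ℝ z ξ : ℝ) • ξ) '' (B ∩ squareChord 0) with hS
  calc _ ≤ ∫⁻ w in orthLine ξ, S.indicator 1 w ∂(Measure.hausdorffMeasure 1) := by
        refine setLIntegral_mono' hmeas fun w hw => ?_
        rw [sliceFun_limitDisp]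
        refine slice_variation_le hξ0 (isOpen_sliceSet isOpen_openSquare ξ w)
          (measurableSet_sliceSet hB ξ w) (w ∈ S) fun hne hmem => ?_
        -- The crossing point with the line `z 0 = 0` projects back to `w`, because `w` is
        -- orthogonal to `ξ`.
        refine ⟨w + (-w 0 / ξ 0) • ξ, ⟨hmem, hBΩ hmem, ?_⟩, ?_⟩
        · simp [hne]
        · have hw0 : inner ℝ w ξ = 0 := hw
          simp only [inner_add_left, real_inner_smul_left, real_inner_self_eq_norm_sq, hξ, hw0]
          simp
    _ ≤ ∫⁻ w, S.indicator 1 w ∂(Measure.hausdorffMeasure 1) := setLIntegral_le_lintegral _ _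
    _ ≤ Measure.hausdorffMeasure 1 S := lintegral_indicator_one_le _
    _ ≤ Measure.hausdorffMeasure 1 (B ∩ squareChord 0) := by
        simpa using (lipschitzWith_sub_inner_smul hξ).hausdorffMeasure_image_le zero_le_one
          (B ∩ squareChord 0)
    _ = (Measure.hausdorffMeasure 1).restrict (squareChord 0) B := by
        rw [Measure.restrict_apply hB]

theorem isGSBD2_limitDisp : IsGSBD2 openSquare limitDisp := by
  refine ⟨isGSBD_limitDisp, ?_, ?_⟩
  · refine (memLp_const (0 : Plane →L[ℝ] Plane)).ae_eq ?_
    filter_upwards [ae_restrict_mem isOpen_openSquare.measurableSet,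
      ae_restrict_of_ae (ae_coord_ne 0)] with x hx hx0
    obtain ⟨c, hc⟩ := limitDisp_eventuallyEq hx0
    exact (approxSymGrad_eq_zero_of_eventuallyEq (isOpen_openSquare.mem_nhds hx) hc).symm
  · rw [jumpSet_limitDisp, hausdorffMeasure_squareChord (by simp)]
    simp

end Limit

/-! ### Maps that are affine, with the same gradient, between two vertical lines -/

section PiecewiseAffine

/-- `f = L + c₁`, `L + c₂`, `L + c₃` to the left of, between and to the right of the lines `z₁ = p`
and `z₁ = q`. -/
structure IsPiecewiseAffine (L : Plane →L[ℝ] Plane) (p q : ℝ) (c₁ c₂ c₃ : Plane)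
    (f : Plane → Plane) : Prop where
  lt : p < q
  left : ∀ z : Plane, z 0 < p → f z = L z + c₁
  mid : ∀ z : Plane, p < z 0 → z 0 < q → f z = L z + c₂
  right : ∀ z : Plane, q < z 0 → f z = L z + c₃

namespace IsPiecewiseAffine

variable {L : Plane →L[ℝ] Plane} {p q : ℝ} {c₁ c₂ c₃ : Plane} {f : Plane → Plane}
  {Ω : Set Plane}

theorem eventuallyEq (h : IsPiecewiseAffine L p q c₁ c₂ c₃ f) {x : Plane} (hp : x 0 ≠ p)
    (hq : x 0 ≠ q) : ∃ c, ∀ᶠ z in 𝓝 x, f z = L z + c := by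
  rcases lt_or_gt_of_ne hp with h1 | h1
  · exact ⟨c₁, by filter_upwards [eventually_coord_lt h1] with z hz using h.left z hz⟩
  rcases lt_or_gt_of_ne hq with h2 | h2
  · exact ⟨c₂, by
      filter_upwards [eventually_lt_coord h1, eventually_coord_lt h2] with z hz hz'
        using h.mid z hz hz'⟩
  · exact ⟨c₃, by filter_upwards [eventually_lt_coord h2] with z hz using h.right z hz⟩

theorem continuousAt (h : IsPiecewiseAffine L p q c₁ c₂ c₃ f) {x : Plane} (hp : x 0 ≠ p)
    (hq : x 0 ≠ q) : ContinuousAt f x := by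
  obtain ⟨c, hc⟩ := h.eventuallyEq hp hq
  exact (L.continuous.add continuous_const).continuousAt.congr
    (by filter_upwards [hc] with z hz using hz.symm)

theorem jumpSet_eq (h : IsPiecewiseAffine L p q c₁ c₂ c₃ f) (h₁₂ : c₁ ≠ c₂) (h₂₃ : c₂ ≠ c₃) :
    jumpSet openSquare f = squareChord p ∪ squareChord q := by
  ext x
  constructor
  · intro hx
    have hxΩ : x ∈ openSquare := by
      obtain ⟨a, b, ν, h⟩ := hx
      exact h.mem
    by_contra hne
    exact notMem_jumpSet_of_continuousAt isOpen_openSquare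
      (h.continuousAt (fun hp => hne (Or.inl ⟨hxΩ, hp⟩)) fun hq => hne (Or.inr ⟨hxΩ, hq⟩)) hx
  · rintro (⟨hx, hxp⟩ | ⟨hx, hxq⟩)
    · refine ⟨_, _, _, IsJumpPoint.of_sides (gR := fun z => L z + c₂) (gL := fun z => L z + c₁) hx
        (by fun_prop) (by fun_prop) ?_ ?_ (by simpa using h₁₂.symm)⟩
      · have hlt : x 0 < q := hxp ▸ h.lt
        filter_upwards [eventually_coord_lt hlt] with z hz hz' using h.mid z (hxp ▸ hz') hz
      · exact Eventually.of_forall fun z hz => h.left z (hxp ▸ hz)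
    · refine ⟨_, _, _, IsJumpPoint.of_sides (gR := fun z => L z + c₃) (gL := fun z => L z + c₂) hx
        (by fun_prop) (by fun_prop) ?_ ?_ (by simpa using h₂₃.symm)⟩
      · exact Eventually.of_forall fun z hz => h.right z (hxq ▸ hz)
      · have hlt : p < x 0 := hxq ▸ h.lt
        filter_upwards [eventually_lt_coord hlt] with z hz hz' using h.mid z hz (hxq ▸ hz')

theorem ae_hasApproxGradAt (h : IsPiecewiseAffine L p q c₁ c₂ c₃ f) :
    ∀ᵐ x ∂(volume.restrict Ω), HasApproxGradAt Ω f L x := by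
  filter_upwards [ae_restrict_of_ae (ae_coord_ne p), ae_restrict_of_ae (ae_coord_ne q)] with x hp hq
  obtain ⟨c, hc⟩ := h.eventuallyEq hp hq
  exact hasApproxGradAt_of_eventuallyEq hc

theorem ae_approxGrad_eq (h : IsPiecewiseAffine L p q c₁ c₂ c₃ f) (hΩ : IsOpen Ω) :
    ∀ᵐ x ∂(volume.restrict Ω), approxGrad Ω f x = L := by
  filter_upwards [ae_restrict_of_ae (ae_coord_ne p), ae_restrict_of_ae (ae_coord_ne q),
    ae_restrict_mem hΩ.measurableSet] with x hp hq hx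
  obtain ⟨c, hc⟩ := h.eventuallyEq hp hq
  exact approxGrad_eq_of_eventuallyEq (hΩ.mem_nhds hx) hc

theorem isGSBV2 (h : IsPiecewiseAffine L p q c₁ c₂ c₃ f) (h₁₂ : c₁ ≠ c₂) (h₂₃ : c₂ ≠ c₃)
    (hf : Measurable f) : IsGSBV2 openSquare f := by
  refine ⟨⟨hf.aestronglyMeasurable, fun ψ hψ _ => ?_⟩, ?_, ?_⟩
  · have hcomp : ∀ c : Plane, ContDiff ℝ 1 fun z => ψ (L z + c) := fun c =>
      hψ.comp (L.contDiff.add contDiff_const)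
    exact isSBVLoc_piecewise isOpen_openSquare h.lt (hcomp c₁) (hcomp c₂) (hcomp c₃)
      (fun z hz => congrArg ψ (h.left z hz)) (fun z hz hz' => congrArg ψ (h.mid z hz hz'))
      (fun z hz => congrArg ψ (h.right z hz))
  · refine (memLp_const L).ae_eq ?_
    filter_upwards [h.ae_approxGrad_eq isOpen_openSquare] with x hx using hx.symm
  · rw [h.jumpSet_eq h₁₂ h₂₃]
    refine (measure_union_le _ _).trans_lt (ENNReal.add_lt_top.2 ⟨?_, ?_⟩) <;>
    exact (hausdorffMeasure_squareChord_le _).trans_lt (by simp)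

theorem linEnergy_eq (h : IsPiecewiseAffine 0 p q c₁ c₂ c₃ f) (hΩ : IsOpen Ω) :
    linEnergy Ω f = Measure.hausdorffMeasure 1 (jumpSet Ω f) := by
  have h0 : ∫⁻ x in Ω, ∑ i : Fin 2, ‖approxSymGrad Ω f x (EuclideanSpace.single i 1)‖ₑ ^ 2 = 0 := by
    refine (lintegral_congr_ae ?_).trans lintegral_zero
    filter_upwards [ae_restrict_of_ae (ae_coord_ne p), ae_restrict_of_ae (ae_coord_ne q),
      ae_restrict_mem hΩ.measurableSet] with x hp hq hx
    obtain ⟨c, hc⟩ := h.eventuallyEq hp hq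
    rw [approxSymGrad_eq_zero_of_eventuallyEq (hΩ.mem_nhds hx) (c := c) (by simpa using hc)]
    simp
  rw [linEnergy, h0, zero_add]

/-- A piecewise translation that is injective off the two lines satisfies the Ciarlet–Nečas
condition. -/
theorem ciarletNecas (h : IsPiecewiseAffine (.id ℝ Plane) p q c₁ c₂ c₃ f) (hΩ : IsOpen Ω)
    (hinj : InjOn f (Ω ∩ {z | z 0 ≠ p ∧ z 0 ≠ q})) : CiarletNecas Ω f := by
  have hdet : ∀ᵐ x ∂(volume.restrict Ω), (approxGrad Ω f x).det = 1 := by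
    filter_upwards [h.ae_approxGrad_eq hΩ] with x hx
    rw [hx]
    exact LinearMap.det_id
  refine ⟨by filter_upwards [hdet] with x hx using hx ▸ one_pos, ?_⟩
  set s : Set Plane := Ω ∩ {z | z 0 ≠ p ∧ z 0 ≠ q} with hs
  have hsm : MeasurableSet s := by
    refine hΩ.measurableSet.inter (MeasurableSet.inter ?_ ?_)
    · exact (isClosed_eq (continuous_coord 0) continuous_const).isOpen_compl.measurableSet
    · exact (isClosed_eq (continuous_coord 0) continuous_const).isOpen_compl.measurableSet
  have hderiv : ∀ x ∈ s, HasFDerivWithinAt f (ContinuousLinearMap.id ℝ Plane) s x := by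
    rintro x ⟨_, hp, hq⟩
    obtain ⟨c, hc⟩ := h.eventuallyEq hp hq
    exact (((ContinuousLinearMap.id ℝ Plane).hasFDerivAt.add_const c).congr_of_eventuallyEq
      hc).hasFDerivWithinAt
  -- Area formula: injectivity on `s` and unit determinant give `volume (f '' s) = volume s`, and
  -- `s` has full measure in `Ω`.
  have himage := lintegral_abs_det_fderiv_eq_addHaar_image volume hsm hderiv hinj
  -- Off the two lines `f` is continuous, so its approximate limit is its value and the measure
  -- theoretic image contains `f '' s`.
  have hsub : f '' s ⊆ mtImage Ω f Ω := by
    rintro _ ⟨x, ⟨hx, hp, hq⟩, rfl⟩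
    refine ⟨x, hx, ?_⟩
    obtain ⟨c, hc⟩ := h.eventuallyEq hp hq
    have hcont := h.continuousAt hp hq
    have hex : (x ∈ Ω ∧ ∃ L, HasApproxGradAt Ω f L x) ∧ ∃ a, HasApLim Ω f x a :=
      ⟨⟨hx, _, hasApproxGradAt_of_eventuallyEq hc⟩, _,
        HasApLim.of_tendsto (hcont.tendsto.mono_left nhdsWithin_le_nhds)⟩
    rw [approxDiffRep, dif_pos hex]
    exact hex.2.choose_spec.eq_of_continuousAt (hΩ.mem_nhds hx) hcont
  have hone : ENNReal.ofReal |(ContinuousLinearMap.id ℝ Plane).det| = 1 := by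
    rw [show (ContinuousLinearMap.id ℝ Plane).det = 1 from LinearMap.det_id]
    simp
  calc ∫⁻ x in Ω, ENNReal.ofReal (approxGrad Ω f x).det = ∫⁻ _ in Ω, 1 := by
        refine lintegral_congr_ae ?_
        filter_upwards [hdet] with x hx
        rw [hx, ENNReal.ofReal_one]
    _ = volume Ω := setLIntegral_one Ω
    _ = volume s := by
        refine measure_congr ?_
        filter_upwards [ae_coord_ne p, ae_coord_ne q] with x hp hq
        exact propext ⟨fun hx => ⟨hx, hp, hq⟩, fun hx => hx.1⟩
    _ = volume (f '' s) := by
        rw [← himage, hone, setLIntegral_one]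
    _ ≤ volume (mtImage Ω f Ω) := measure_mono hsub

end IsPiecewiseAffine

end PiecewiseAffine

/-! ### The approximating sequence -/

section Sequence

variable {ε : ℝ}

theorem measurable_seqDisp (ε : ℝ) : Measurable (seqDisp ε) :=
  (measurable_const.indicator (isOpen_halfPlane 0).measurableSet).add
    (measurable_const.indicator ((isOpen_lt continuous_const (continuous_coord 0)).inter
      (isOpen_lt (continuous_coord 0) continuous_const)).measurableSet)

theorem isPiecewiseAffine_seqDisp (hε : 0 < ε) :
    IsPiecewiseAffine 0 (-(2 * ε)) 0 0 !₂[2 / ε, 0] !₂[-1, 0] (seqDisp ε) where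
  lt := by linarith
  left z hz := by
    have h0 : ¬ 0 < z 0 := by linarith
    have h1 : ¬ (-(2 * ε) < z 0 ∧ z 0 < 0) := fun h => by linarith [h.1]
    rw [seqDisp, indicator_of_notMem (by exact h0), indicator_of_notMem (by exact h1)]
    simp
  mid z hz hz' := by
    rw [seqDisp, indicator_of_notMem (by exact hz'.not_gt), indicator_of_mem (by exact ⟨hz, hz'⟩)]
    simp
  right z hz := by
    have h1 : ¬ (-(2 * ε) < z 0 ∧ z 0 < 0) := fun h => by linarith [h.2]
    rw [seqDisp, indicator_of_mem (by exact hz), indicator_of_notMem (by exact h1)]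
    simp

theorem isPiecewiseAffine_seqDef (hε : 0 < ε) :
    IsPiecewiseAffine (.id ℝ Plane) (-(2 * ε)) 0 0 !₂[2, 0] !₂[-ε, 0] (seqDef ε) where
  lt := by linarith
  left z hz := by
    rw [seqDef, (isPiecewiseAffine_seqDisp hε).left z hz]
    simp
  mid z hz hz' := by
    rw [seqDef, (isPiecewiseAffine_seqDisp hε).mid z hz hz']
    ext i
    fin_cases i
    · simp; field_simp
    · simp
  right z hz := by
    rw [seqDef, (isPiecewiseAffine_seqDisp hε).right z hz]
    ext i
    fin_cases i <;> simp

theorem seqDisp_shift_ne (hε : 0 < ε) : (0 : Plane) ≠ !₂[2 / ε, 0] ∧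
    (!₂[2 / ε, 0] : Plane) ≠ !₂[-1, 0] := by
  have h2 : 0 < 2 / ε := by positivity
  constructor <;> intro h <;> have := congrArg (fun v : Plane => v 0) h <;>
    simp only [PiLp.zero_apply, Matrix.cons_val_zero] at this <;> linarith

theorem jumpSet_seqDisp (hε : 0 < ε) :
    jumpSet openSquare (seqDisp ε) = squareChord (-(2 * ε)) ∪ squareChord 0 :=
  (isPiecewiseAffine_seqDisp hε).jumpSet_eq (seqDisp_shift_ne hε).1 (seqDisp_shift_ne hε).2

theorem seqDef_shift_ne (hε : 0 < ε) : (0 : Plane) ≠ !₂[2, 0] ∧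
    (!₂[2, 0] : Plane) ≠ !₂[-ε, 0] := by
  constructor <;> intro h <;> have := congrArg (fun v : Plane => v 0) h <;>
    simp only [PiLp.zero_apply, Matrix.cons_val_zero] at this <;> linarith

theorem jumpSet_seqDef (hε : 0 < ε) :
    jumpSet openSquare (seqDef ε) = squareChord (-(2 * ε)) ∪ squareChord 0 :=
  (isPiecewiseAffine_seqDef hε).jumpSet_eq (seqDef_shift_ne hε).1 (seqDef_shift_ne hε).2

theorem hausdorffMeasure_jumpSet_seqDef_le (hε : 0 < ε) :
    Measure.hausdorffMeasure 1 (jumpSet openSquare (seqDef ε)) ≤ 4 := by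
  rw [jumpSet_seqDef hε]
  calc _ ≤ Measure.hausdorffMeasure 1 (squareChord (-(2 * ε))) +
        Measure.hausdorffMeasure 1 (squareChord 0) := measure_union_le _ _
    _ ≤ 2 + 2 := add_le_add (hausdorffMeasure_squareChord_le _) (hausdorffMeasure_squareChord_le _)
    _ = 4 := by norm_num

theorem hausdorffMeasure_jumpSet_seqDef (hε : 0 < ε) (hε' : ε < 1 / 2) :
    Measure.hausdorffMeasure 1 (jumpSet openSquare (seqDef ε)) = 4 := by
  have hdisj : Disjoint (squareChord (-(2 * ε))) (squareChord 0) := by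
    rw [Set.disjoint_left]
    rintro x ⟨_, h1⟩ ⟨_, h2⟩
    linarith
  rw [jumpSet_seqDef hε, measure_union hdisj (measurableSet_squareChord 0),
    hausdorffMeasure_squareChord ⟨by linarith, by linarith⟩,
    hausdorffMeasure_squareChord (by simp)]
  norm_num

theorem linEnergy_seqDisp (hε : 0 < ε) : linEnergy openSquare (seqDisp ε) =
    Measure.hausdorffMeasure 1 (jumpSet openSquare (seqDef ε)) := by
  rw [(isPiecewiseAffine_seqDisp hε).linEnergy_eq isOpen_openSquare, jumpSet_seqDef hε,
    jumpSet_seqDisp hε]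

theorem rescaledDisp_seqDef (hε : 0 < ε) : rescaledDisp ε (seqDef ε) = seqDisp ε := by
  ext1 x
  rw [rescaledDisp, seqDef, add_sub_cancel_left, inv_smul_smul₀ hε.ne']

theorem injOn_seqDef (hε : 0 < ε) :
    InjOn (seqDef ε) (openSquare ∩ {z | z 0 ≠ -(2 * ε) ∧ z 0 ≠ 0}) := by
  have hcases : ∀ z ∈ openSquare ∩ {z : Plane | z 0 ≠ -(2 * ε) ∧ z 0 ≠ 0},
      seqDef ε z 1 = z 1 ∧ -1 < z 0 ∧ z 0 < 1 ∧
        (z 0 < -(2 * ε) ∧ seqDef ε z 0 = z 0 ∨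
          -(2 * ε) < z 0 ∧ z 0 < 0 ∧ seqDef ε z 0 = z 0 + 2 ∨
          0 < z 0 ∧ seqDef ε z 0 = z 0 - ε) := by
    rintro z ⟨hz, hp, hq⟩
    have h := isPiecewiseAffine_seqDef hε
    have hbd := hz 0
    rcases lt_or_gt_of_ne hp with h1 | h1
    · rw [h.left z h1]
      simp [h1, hbd.1, hbd.2]
    rcases lt_or_gt_of_ne hq with h2 | h2
    · rw [h.mid z h1 h2]
      simp [h1, h2, hbd.1, hbd.2]
    · rw [h.right z h2]
      simp [h2, hbd.1, hbd.2, sub_eq_add_neg]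
  intro x hx y hy hxy
  obtain ⟨hx1, hxl, hxr, hx⟩ := hcases x hx
  obtain ⟨hy1, hyl, hyr, hy⟩ := hcases y hy
  rw [hxy] at hx1 hx
  have h0 : x 0 = y 0 := by
    -- Points of different pieces have different images: the left piece stays below `-2ε`, the right
    -- half lands between `-ε` and `1 - ε`, and the thrown strip lies beyond 1 because `-1 < z 0`.
    -- This needs no smallness of `ε`.
    rcases hx with ⟨_, hx⟩ | ⟨_, _, hx⟩ | ⟨_, hx⟩ <;> rcases hy with ⟨_, hy⟩ | ⟨_, _, hy⟩ | ⟨_, hy⟩ <;>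
      linarith
  ext i
  fin_cases i
  · exact h0
  · exact hx1.symm.trans hy1

theorem tendstoInMeasure_seqDisp :
    TendstoInMeasure (volume.restrict openSquare) seqDisp (𝓝[>] 0) limitDisp := by
  intro η hη
  -- The two maps agree outside the strip `-2ε < z 0 < 0`, whose part in the square has area at most
  -- its width `2ε` times the height 2.
  have hlim : Tendsto (fun ε : ℝ => ENNReal.ofReal (0 - -(2 * ε)) * 2) (𝓝[>] 0) (𝓝 0) := by
    have h1 : Tendsto (fun ε : ℝ => ENNReal.ofReal (0 - -(2 * ε))) (𝓝 0) (𝓝 0) := by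
      have hc : Continuous fun ε : ℝ => ENNReal.ofReal (0 - -(2 * ε)) :=
        ENNReal.continuous_ofReal.comp (by fun_prop)
      simpa using hc.tendsto 0
    have h2 := ENNReal.Tendsto.mul_const (b := 2) h1 (Or.inr (by simp))
    rw [zero_mul] at h2
    exact h2.mono_left nhdsWithin_le_nhds
  refine tendsto_of_tendsto_of_tendsto_of_le_of_le' tendsto_const_nhds hlim
    (Eventually.of_forall fun _ => zero_le) (Eventually.of_forall fun ε => ?_)
  rw [Measure.restrict_apply' isOpen_openSquare.measurableSet]
  refine (measure_mono ?_).trans (volume_strip_le _ _)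
  rintro z ⟨hz, hzΩ⟩
  refine ⟨hzΩ, ?_⟩
  by_contra hmem
  refine absurd (show η ≤ edist (seqDisp ε z) (limitDisp z) from hz) (not_le.2 ?_)
  have : seqDisp ε z = limitDisp z := by
    rw [seqDisp, indicator_of_notMem (s := {x : Plane | -(2 * ε) < x 0 ∧ x 0 < 0}) (by exact hmem),
      add_zero, limitDisp]
  rw [this, edist_self]
  exact hη

end Sequence

/-! ### Assembly of the counterexample -/

theorem mainTheorem7 :
    -- the limit `u`, its jump, and the failure of the contact condition
    IsGSBD2 openSquare limitDisp ∧
    jumpSet openSquare limitDisp = {x | x ∈ openSquare ∧ x 0 = 0} ∧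
    (∀ x ∈ jumpSet openSquare limitDisp,
      ∃ a b : Plane, IsJumpPoint openSquare limitDisp x a b e₁ ∧ a - b = -e₁) ∧
    (∀ x ∈ jumpSet openSquare limitDisp, ∀ a b ν : Plane,
      IsJumpPoint openSquare limitDisp x a b ν → inner ℝ ν (a - b) = -1) ∧
    ¬ ContactCondition openSquare limitDisp ∧
    -- the deformations `y_ε` and the displacements `u_ε`
    (∀ ε : ℝ, 0 < ε →
      IsGSBV2 openSquare (seqDef ε) ∧
      IsGSBV2 openSquare (seqDisp ε) ∧
      rescaledDisp ε (seqDef ε) = seqDisp ε ∧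
      (∀ᵐ x ∂(volume.restrict openSquare),
        HasApproxGradAt openSquare (seqDef ε) (ContinuousLinearMap.id ℝ Plane) x) ∧
      (∀ᵐ x ∂(volume.restrict openSquare), HasApproxGradAt openSquare (seqDisp ε) 0 x) ∧
      CiarletNecas openSquare (seqDef ε) ∧
      Measure.hausdorffMeasure 1 (jumpSet openSquare (seqDef ε)) ≤ 4 ∧
      (ε < 1 / 2 → Measure.hausdorffMeasure 1 (jumpSet openSquare (seqDef ε)) = 4) ∧
      linEnergy openSquare (seqDisp ε) =
        Measure.hausdorffMeasure 1 (jumpSet openSquare (seqDef ε))) ∧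
    (⨆ ε : Ioi (0 : ℝ), linEnergy openSquare (seqDisp ε)) < ⊤ ∧
    TendstoInMeasure (volume.restrict openSquare) seqDisp (𝓝[>] 0) limitDisp ∧
    -- the Ciarlet–Nečas condition and energy bounds do not give the contact condition in the limit
    ¬ (∀ (y : ℝ → Plane → Plane) (u : Plane → Plane),
        (∀ ε : ℝ, 0 < ε → IsGSBV2 openSquare (y ε) ∧ CiarletNecas openSquare (y ε)) →
        (⨆ ε : Ioi (0 : ℝ), linEnergy openSquare (rescaledDisp ε (y ε))) < ⊤ →
        IsGSBD2 openSquare u →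
        TendstoInMeasure (volume.restrict openSquare) (fun ε => rescaledDisp ε (y ε))
          (𝓝[>] 0) u →
        ContactCondition openSquare u) := by
  have hseq : ∀ ε : ℝ, 0 < ε → IsGSBV2 openSquare (seqDef ε) ∧ CiarletNecas openSquare (seqDef ε) :=
    fun ε hε => ⟨(isPiecewiseAffine_seqDef hε).isGSBV2 (seqDef_shift_ne hε).1 (seqDef_shift_ne hε).2
      (measurable_id.add ((measurable_seqDisp ε).const_smul ε)),
      (isPiecewiseAffine_seqDef hε).ciarletNecas isOpen_openSquare (injOn_seqDef hε)⟩
  have hsup : (⨆ ε : Ioi (0 : ℝ), linEnergy openSquare (seqDisp ε)) < ⊤ :=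
    (iSup_le fun ε : Ioi (0 : ℝ) => (linEnergy_seqDisp ε.2).trans_le
      (hausdorffMeasure_jumpSet_seqDef_le ε.2)).trans_lt (by simp : (4 : ℝ≥0∞) < ⊤)
  refine ⟨isGSBD2_limitDisp, jumpSet_limitDisp, fun x hx => ?_,
    fun x _ a b ν h => inner_normal_jump_limitDisp h, not_contactCondition_limitDisp,
    fun ε hε => ⟨(hseq ε hε).1, (isPiecewiseAffine_seqDisp hε).isGSBV2 (seqDisp_shift_ne hε).1
      (seqDisp_shift_ne hε).2 (measurable_seqDisp ε), rescaledDisp_seqDef hε,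
      (isPiecewiseAffine_seqDef hε).ae_hasApproxGradAt,
      (isPiecewiseAffine_seqDisp hε).ae_hasApproxGradAt, (hseq ε hε).2,
      hausdorffMeasure_jumpSet_seqDef_le hε, hausdorffMeasure_jumpSet_seqDef hε,
      linEnergy_seqDisp hε⟩, hsup, tendstoInMeasure_seqDisp, fun h => ?_⟩
  · rw [jumpSet_limitDisp] at hx
    exact ⟨_, _, isJumpPoint_limitDisp hx.1 hx.2, sub_zero _⟩
  · refine not_contactCondition_limitDisp (h seqDef limitDisp hseq ?_ isGSBD2_limitDisp ?_)
    · exact (iSup_congr fun ε : Ioi (0 : ℝ) => by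
        rw [rescaledDisp_seqDef ε.2]).trans_lt hsup
    -- The identity between the rescaled displacement and `seqDisp ε` is available for `ε > 0`,
    -- which is all that the one-sided limit sees.
    · refine tendstoInMeasure_seqDisp.congr' ?_ (EventuallyEq.refl _ _)
      filter_upwards [self_mem_nhdsWithin] with ε hε
      rw [rescaledDisp_seqDef hε]
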